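/- Let $V=\mathbb{C}^3$, let $a,b\ge 0$ be integers, $\mu=(a+b+1,a)$, $\nu=(a+b+1,a+1)$, $m=\dim S_\mu V$ and $n=\dim S_\nu V$, where $S_\lambda V$ denotes the irreducible polynomial representation of $GL(V)$ of highest weight $\lambda$. Let $T_{a,b}\in V^*\otimes S_\mu V^*\otimes S_\nu V$ be the $GL(V)$-invariant tensor (nonzero, and unique up to scale) corresponding to the map $V\to\operatorname{Hom}(S_\mu V,S_\nu V)$, $v\mapsto (u\mapsto P(u\otimes v))$, where $P\colon S_\mu V\otimes V\to S_\nu V$ is the $GL(V)$-equivariant projection. Let $T_{a,b}^{\wedge 1}\colon V^*\otimes S_\nu V^*\to V^*\otimes V^*\otimes S_\mu V^*\to \Lambda^2V^*\otimes S_\mu V^*$ be its first Koszul flattening: the first map contracts $T_{a,b}$ with the element of $S_\nu V^*$, and the second wedges the two factors $V^*$. Write $\underline{R}$ for border rank (the least $r$ such that the tensor is a limit of sums of $r$ rank one tensors). Then $$\operatorname{rk}(T_{a,b}^{\wedge1})=m+n+a+b+3,$$ so that the border rank lower bound given by the first Koszul flattening is $$\underline{R}(T_{a,b})\ \ge\ \left\lceil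 \operatorname{rk}(T_{a,b}^{\wedge1})\Big/\tbinom{2}{1}\right\rceil=\left\lceil\tfrac{m+n+a+b+3}{2}\right\rceil .$$ This bound exceeds $\max\{m,n\}$ only if $|a-b|\le 1$. Moreover: (i) if $a=b$, then $m=n$ and $\underline{R}(T_{a,b})\ge m+a+2$; (ii) if $b=a+1$, then $\max\{m,n\}=n$ and $\underline{R}(T_{a,b})\ge n+\lceil a/2\rceil+1$; (iii) if $a=b+1$, then $\max\{m,n\}=m$ and $\underline{R}(T_{a,b})\ge m+\lceil b/2\rceil+1$. -/

import Mathlib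

open scoped TensorProduct
open Filter Topology

noncomputable section

/-! ### Border rank of a tensor in `A ⊗ B ⊗ C` -/

section BorderRank

variable {A B C : Type*} [AddCommGroup A] [Module ℂ A] [AddCommGroup B] [Module ℂ B]
  [AddCommGroup C] [Module ℂ C]

/-- `T` is a sum of `r` tensors of the form `a ⊗ b ⊗ c`, that is, `R(T) ≤ r`. -/
def TensorRankLE (T : A ⊗[ℂ] (B ⊗[ℂ] C)) (r : ℕ) : Prop :=
  ∃ (a : Fin r → A) (b : Fin r → B) (c : Fin r → C),
    T = ∑ i, a i ⊗ₜ[ℂ] (b i ⊗ₜ[ℂ] c i)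

/-- `T` is the limit of a sequence of tensors of rank at most `r`. On a finite-dimensional complex
vector space the module topology is the usual (Euclidean) topology. -/
def BorderRankLE (T : A ⊗[ℂ] (B ⊗[ℂ] C)) (r : ℕ) : Prop :=
  ∃ S : ℕ → A ⊗[ℂ] (B ⊗[ℂ] C), (∀ k, TensorRankLE (S k) r) ∧
    Tendsto S atTop (@nhds _ (moduleTopology ℂ (A ⊗[ℂ] (B ⊗[ℂ] C))) T)

/-- The border rank: the smallest `r` such that `T` is a limit of sums of `r` rank one tensors. -/
def borderRank (T : A ⊗[ℂ] (B ⊗[ℂ] C)) : ℕ :=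
  sInf {r : ℕ | BorderRankLE T r}

/-- Every tensor has finite border rank, so the infimum above is a minimum. -/
theorem exists_borderRankLE (T : A ⊗[ℂ] (B ⊗[ℂ] C)) : ∃ r, BorderRankLE T r := by
  suffices h : ∃ r, TensorRankLE T r by
    obtain ⟨r, hr⟩ := h
    let _ := moduleTopology ℂ (A ⊗[ℂ] (B ⊗[ℂ] C))
    exact ⟨r, fun _ => T, fun _ => hr, tendsto_const_nhds⟩
  have add : ∀ x y : A ⊗[ℂ] (B ⊗[ℂ] C), (∃ r, TensorRankLE x r) → (∃ r, TensorRankLE y r) →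
      ∃ r, TensorRankLE (x + y) r := by
    rintro x y ⟨r, a, b, c, rfl⟩ ⟨s, a', b', c', rfl⟩
    exact ⟨r + s, Fin.append a a', Fin.append b b', Fin.append c c', by simp [Fin.sum_univ_add]⟩
  have zero : ∃ r, TensorRankLE (0 : A ⊗[ℂ] (B ⊗[ℂ] C)) r :=
    ⟨0, Fin.elim0, Fin.elim0, Fin.elim0, by simp⟩
  induction T with
  | zero => exact zero
  | add x y hx hy => exact add x y hx hy
  | tmul x y =>
    induction y with
    | zero => simpa using zero
    | add y z hy hz => rw [TensorProduct.tmul_add]; exact add _ _ hy hz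
    | tmul y z => exact ⟨1, fun _ => x, fun _ => y, fun _ => z, by simp⟩

/-! ### The first Koszul flattening -/

/-- The map `A → Λ² A`, `a' ↦ a ∧ a'`, linear in `a`. -/
def wedgeLeft : A →ₗ[ℂ] A →ₗ[ℂ] ⋀[ℂ]^2 A :=
  have e₀ : ∀ x y z : A, Function.update ![x, y] 0 z = ![z, y] := fun x y z => by
    ext i; fin_cases i <;> simp
  have e₁ : ∀ x y z : A, Function.update ![x, y] 1 z = ![x, z] := fun x y z => by
    ext i; fin_cases i <;> simp
  LinearMap.mk₂ ℂ (fun a a' => exteriorPower.ιMulti ℂ 2 ![a, a'])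
    (fun x y z => by
      have h := (exteriorPower.ιMulti ℂ (M := A) 2).map_update_add ![x, z] 0 x y
      rwa [e₀, e₀, e₀] at h)
    (fun c x z => by
      have h := (exteriorPower.ιMulti ℂ (M := A) 2).map_update_smul ![x, z] 0 c x
      rwa [e₀, e₀] at h)
    (fun x y z => by
      have h := (exteriorPower.ιMulti ℂ (M := A) 2).map_update_add ![x, y] 1 y z
      rwa [e₁, e₁, e₁] at h)
    (fun c x z => by
      have h := (exteriorPower.ιMulti ℂ (M := A) 2).map_update_smul ![x, z] 1 c z
      rwa [e₁, e₁] at h)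

/-- Contraction of `T ∈ A ⊗ B ⊗ C` with `γ ∈ C*`: the map `T_C : C* → A ⊗ B`, which sends `γ` to
`γ(c) • a ⊗ b` if `T = a ⊗ b ⊗ c`. -/
def contractThird (T : A ⊗[ℂ] (B ⊗[ℂ] C)) : Module.Dual ℂ C →ₗ[ℂ] A ⊗[ℂ] B where
  toFun γ := (TensorProduct.rid ℂ B ∘ₗ γ.lTensor B).lTensor A T
  map_add' γ δ := by
    simp [LinearMap.lTensor_add, LinearMap.comp_add]
  map_smul' t γ := by
    simp [LinearMap.lTensor_smul, LinearMap.comp_smul]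

/-- The first Koszul flattening `T^{∧1} : A ⊗ C* → A ⊗ A ⊗ B → Λ² A ⊗ B`, which sends `a' ⊗ γ` to
`γ(c) • (a' ∧ a) ⊗ b` if `T = a ⊗ b ⊗ c`. -/
def koszulFlattening (T : A ⊗[ℂ] (B ⊗[ℂ] C)) :
    A ⊗[ℂ] Module.Dual ℂ C →ₗ[ℂ] (⋀[ℂ]^2 A) ⊗[ℂ] B :=
  (TensorProduct.lift wedgeLeft).rTensor B ∘ₗ
    (TensorProduct.assoc ℂ A A B).symm.toLinearMap ∘ₗ (contractThird T).lTensor A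

theorem koszulFlattening_tmul (a a' : A) (b : B) (c : C) (γ : Module.Dual ℂ C) :
    koszulFlattening (a ⊗ₜ[ℂ] (b ⊗ₜ[ℂ] c)) (a' ⊗ₜ γ) =
      γ c • (exteriorPower.ιMulti ℂ 2 ![a', a] ⊗ₜ[ℂ] b) := by
  simp [koszulFlattening, contractThird, wedgeLeft]

/-- The rank of a linear map. -/
def linRank {M N : Type*} [AddCommMonoid M] [Module ℂ M] [AddCommMonoid N] [Module ℂ N]
    (f : M →ₗ[ℂ] N) : ℕ :=
  Module.finrank ℂ (LinearMap.range f)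

end BorderRank

/-! ### Schur modules -/

/-- The polynomial ring in the entries `Z_{r,j}` of a matrix with rows `r = 0, 1, 2, …` and `k`
columns. -/
abbrev MatrixPoly (k : ℕ) : Type := MvPolynomial (ℕ × Fin k) ℂ

/-- The polynomial `D_t` of a filling `t` of the Young diagram `μ` with numbers in `{1, …, k}`:
the product over the columns of `μ` of the minors of the generic matrix `Z` on the topmost rows
and on the columns of `Z` listed in that column of `t`. (`t i j` is the entry of the cell in row
`i` and column `j`; the entries outside `μ` play no role.) -/
def fillingPoly {k : ℕ} (μ : YoungDiagram) (t : ℕ → ℕ → Fin k) : MatrixPoly k :=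
  ∏ j ∈ Finset.range (μ.rowLen 0),
    (Matrix.of fun r i : Fin (μ.colLen j) =>
      (MvPolynomial.X ((r : ℕ), t i j) : MatrixPoly k)).det

/-- The Schur module `S_μ(ℂ^k)`, the irreducible polynomial representation of `GL_k` of highest
weight `μ`, in its classical realization as the span of the products `D_t` of minors. -/
def SchurModule (k : ℕ) (μ : YoungDiagram) : Submodule ℂ (MatrixPoly k) :=
  Submodule.span ℂ (Set.range (fillingPoly (k := k) μ))

instance schurModule_finite (k : ℕ) (μ : YoungDiagram) :
    Module.Finite ℂ (SchurModule k μ) := by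
  classical
  rw [SchurModule, Module.Finite.iff_fg]
  refine Submodule.fg_span ?_
  rcases isEmpty_or_nonempty (Fin k) with h | ⟨⟨d⟩⟩
  · have : IsEmpty (ℕ → ℕ → Fin k) := ⟨fun t => h.elim (t 0 0)⟩
    exact Set.finite_range _
  · refine (Set.finite_range fun s : μ.cells → Fin k =>
      fillingPoly μ fun i j => if hc : (i, j) ∈ μ.cells then s ⟨(i, j), hc⟩ else d).subset ?_
    rintro _ ⟨t, rfl⟩
    refine ⟨fun c => t c.1.1 c.1.2, ?_⟩
    refine Finset.prod_congr rfl fun j _ => ?_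
    congr 1
    ext1 r i
    have : ((i : ℕ), j) ∈ μ := YoungDiagram.mem_iff_lt_colLen.2 i.2
    simp [this]

/-- The element of degree one `∑_j v_j Z_{r,j}`. -/
def rowForm {k : ℕ} (r : ℕ) : (Fin k → ℂ) →ₗ[ℂ] MatrixPoly k :=
  ∑ j, (LinearMap.proj j).smulRight (MvPolynomial.X (r, j))

theorem rowForm_apply {k : ℕ} (r : ℕ) (v : Fin k → ℂ) :
    rowForm r v = ∑ j, v j • (MvPolynomial.X (r, j) : MatrixPoly k) := by
  simp [rowForm]

/-- The action of a `k × k` matrix (in particular of an element of `GL_k`) on polynomials in `Z`: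
`Z_{r,j} ↦ ∑_i g_{ij} Z_{r,i}`, that is, the action induced by that on `ℂ^k` in each row. -/
def matAct {k : ℕ} (g : Matrix (Fin k) (Fin k) ℂ) : MatrixPoly k →ₐ[ℂ] MatrixPoly k :=
  MvPolynomial.aeval fun p => rowForm p.1 (g.col p.2)

/-! ### The invariant tensors `T_{a,b}` -/

/-- The partition `(p, q)` with at most two rows, `q ≤ p`. -/
def twoRow (p q : ℕ) (h : q ≤ p) : YoungDiagram :=
  YoungDiagram.ofRowLens [p, q] (by simpa [List.sortedGE_iff_pairwise] using h)

theorem mem_twoRow {p q : ℕ} (h : q ≤ p) {i j : ℕ} :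
    (i, j) ∈ twoRow p q h ↔ (i = 0 ∧ j < p) ∨ (i = 1 ∧ j < q) := by
  rw [twoRow, YoungDiagram.mem_ofRowLens]
  constructor
  · rintro ⟨hi, hj⟩
    simp only [List.length_cons, List.length_nil] at hi
    interval_cases i <;> simp_all
  · rintro (⟨rfl, hj⟩ | ⟨rfl, hj⟩)
    · exact ⟨by simp, by simpa using hj⟩
    · exact ⟨by simp, by simpa using hj⟩

/-- The minor on the two topmost rows and the columns `i`, `j`. -/
def minorTwo {k : ℕ} (i j : Fin k) : MatrixPoly k :=
  MvPolynomial.X (0, i) * MvPolynomial.X (1, j) - MvPolynomial.X (0, j) * MvPolynomial.X (1, i)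

theorem fillingPoly_twoRow {k p q : ℕ} (h : q ≤ p) (t : ℕ → ℕ → Fin k) :
    fillingPoly (twoRow p q h) t =
      (∏ j ∈ Finset.range q, minorTwo (t 0 j) (t 1 j)) *
        ∏ j ∈ Finset.Ico q p, MvPolynomial.X (0, t 0 j) := by
  have hrow : (twoRow p q h).rowLen 0 = p := by
    refine eq_of_forall_lt_iff fun j => ?_
    rw [← YoungDiagram.mem_iff_lt_rowLen, mem_twoRow]
    simp
  have key : ∀ (n j : ℕ),
      (n = 2 → (Matrix.of fun r i : Fin n =>
        (MvPolynomial.X ((r : ℕ), t i j) : MatrixPoly k)).det = minorTwo (t 0 j) (t 1 j)) ∧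
      (n = 1 → (Matrix.of fun r i : Fin n =>
        (MvPolynomial.X ((r : ℕ), t i j) : MatrixPoly k)).det = MvPolynomial.X (0, t 0 j)) := by
    intro n j
    constructor
    · rintro rfl
      simp [Matrix.det_fin_two, minorTwo]
    · rintro rfl
      simp
  rw [fillingPoly, hrow, ← Finset.prod_range_mul_prod_Ico _ h]
  congr 1
  · refine Finset.prod_congr rfl fun j hj => (key _ j).1 ?_
    rw [Finset.mem_range] at hj
    refine eq_of_forall_lt_iff fun i => ?_
    rw [← YoungDiagram.mem_iff_lt_colLen, mem_twoRow]
    omega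
  · refine Finset.prod_congr rfl fun j hj => (key _ j).2 ?_
    rw [Finset.mem_Ico] at hj
    refine eq_of_forall_lt_iff fun i => ?_
    rw [← YoungDiagram.mem_iff_lt_colLen, mem_twoRow]
    omega

/-- The polarization derivation `∑_j Z_{1,j} ∂/∂Z_{0,j}`. -/
def polarize (k : ℕ) : Derivation ℂ (MatrixPoly k) (MatrixPoly k) :=
  MvPolynomial.mkDerivation ℂ fun p =>
    if p.1 = 0 then MvPolynomial.X (1, p.2) else 0

theorem polarize_prod {k : ℕ} (s : Finset ℕ) (f : ℕ → MatrixPoly k) :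
    polarize k (∏ j ∈ s, f j) = ∑ j ∈ s, polarize k (f j) * ∏ i ∈ s.erase j, f i := by
  classical
  induction s using Finset.induction_on with
  | empty => simp
  | insert x s hx ih =>
    rw [Finset.prod_insert hx, Derivation.leibniz, ih, Finset.sum_insert hx,
      Finset.erase_insert hx, smul_eq_mul, smul_eq_mul, add_comm, mul_comm (∏ j ∈ s, f j),
      Finset.mul_sum]
    congr 1
    refine Finset.sum_congr rfl fun j hj => ?_
    have hne : x ≠ j := fun h => hx (h ▸ hj)
    rw [Finset.erase_insert_of_ne hne, Finset.prod_insert (by simp [hx])]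
    ring

/-- The bilinear map `(v, u) ↦ c • v(Z_1) u - v(Z_0) ∑_j Z_{1,j} ∂u/∂Z_{0,j}`, where
`v(Z_r) = ∑_j v_j Z_{r,j}`. -/
def addCellPoly (k : ℕ) (c : ℂ) : (Fin k → ℂ) →ₗ[ℂ] MatrixPoly k →ₗ[ℂ] MatrixPoly k :=
  LinearMap.mk₂ ℂ
    (fun v u => c • (rowForm 1 v * u) - rowForm 0 v * polarize k u)
    (fun v w u => by simp only [map_add, add_mul, smul_add]; abel)
    (fun s v u => by
      simp only [map_smul, smul_mul_assoc, smul_sub, smul_comm c s])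
    (fun v u w => by simp only [map_add, mul_add, smul_add]; abel)
    (fun s v u => by
      simp only [Derivation.map_smul, mul_smul_comm, smul_sub, smul_comm c s])

theorem addCellPoly_apply (k : ℕ) (c : ℂ) (v : Fin k → ℂ) (u : MatrixPoly k) :
    addCellPoly k c v u = c • (rowForm 1 v * u) - rowForm 0 v * polarize k u := rfl

/-- The bilinear map above commutes with the action of `GL_k`. -/
theorem addCellPoly_matAct (k : ℕ) (c : ℂ) (g : Matrix (Fin k) (Fin k) ℂ) (v : Fin k → ℂ)
    (u : MatrixPoly k) :
    addCellPoly k c (g.mulVec v) (matAct g u) = matAct g (addCellPoly k c v u) := by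
  have hX : ∀ p : ℕ × Fin k, matAct g (MvPolynomial.X p) = rowForm p.1 (g.col p.2) := fun p => by
    simp [matAct]
  have hv : ∀ r, rowForm r (g.mulVec v) = matAct g (rowForm r v) := fun r => by
    simp only [rowForm_apply, map_sum, map_smul, hX, Matrix.mulVec, dotProduct, Finset.smul_sum,
      Finset.sum_smul]
    rw [Finset.sum_comm]
    refine Finset.sum_congr rfl fun i _ => Finset.sum_congr rfl fun j _ => ?_
    rw [smul_smul, mul_comm, Matrix.col_apply]
  have hp : polarize k (matAct g u) = matAct g (polarize k u) := by
    induction u using MvPolynomial.induction_on with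
    | C x => simp [← MvPolynomial.algebraMap_eq]
    | add x y hx hy => simp [hx, hy]
    | mul_X x p hx =>
      have : polarize k (rowForm p.1 (g.col p.2)) =
          matAct g (polarize k (MvPolynomial.X p)) := by
        rcases p with ⟨r, j⟩
        by_cases hr : r = 0 <;> simp [polarize, rowForm_apply, hr, hX]
      simp [Derivation.leibniz, hx, hX, this]
  simp [addCellPoly_apply, hv, hp]

/-- On a product of minors the map with `c = b + 1` places `v` below each of the `b + 1` columns of
length one in turn, and adds up the results: a column `i` of length one contributes the factor
`∑_l v_l (Z_{0,i} Z_{1,l} - Z_{0,l} Z_{1,i})` in place of `Z_{0,i}`. -/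
theorem addCellPoly_fillingPoly {k : ℕ} (a b : ℕ) (v : Fin k → ℂ) (t : ℕ → ℕ → Fin k) :
    addCellPoly k (b + 1) v (fillingPoly (twoRow (a + b + 1) a (by omega)) t) =
      ∑ j ∈ Finset.Ico a (a + b + 1), ∑ l, v l •
        ((∏ i ∈ Finset.range a, minorTwo (t 0 i) (t 1 i)) * (minorTwo (t 0 j) l *
          ∏ i ∈ (Finset.Ico a (a + b + 1)).erase j, MvPolynomial.X (0, t 0 i))) := by
  rw [fillingPoly_twoRow, addCellPoly_apply]
  set M : MatrixPoly k := ∏ i ∈ Finset.range a, minorTwo (t 0 i) (t 1 i)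
  have hminor : ∀ i j : Fin k, polarize k (minorTwo i j) = 0 := fun i j => by
    simp [minorTwo, polarize, Derivation.leibniz]
    ring
  have hM : polarize k M = 0 := by
    rw [polarize_prod]
    simp [hminor]
  have hL : polarize k (∏ j ∈ Finset.Ico a (a + b + 1),
      (MvPolynomial.X (0, t 0 j) : MatrixPoly k)) =
      ∑ j ∈ Finset.Ico a (a + b + 1), MvPolynomial.X (1, t 0 j) *
        ∏ i ∈ (Finset.Ico a (a + b + 1)).erase j, MvPolynomial.X (0, t 0 i) := by
    rw [polarize_prod]
    refine Finset.sum_congr rfl fun j _ => ?_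
    simp [polarize]
  have hcard : ((b : ℂ) + 1) • (rowForm 1 v * (M * ∏ j ∈ Finset.Ico a (a + b + 1),
      (MvPolynomial.X (0, t 0 j) : MatrixPoly k))) =
      ∑ j ∈ Finset.Ico a (a + b + 1), rowForm 1 v * (M * (MvPolynomial.X (0, t 0 j) *
        ∏ i ∈ (Finset.Ico a (a + b + 1)).erase j, MvPolynomial.X (0, t 0 i))) := by
    rw [Finset.sum_congr rfl fun j hj => congrArg (fun z => rowForm 1 v * (M * z))
      (Finset.mul_prod_erase _ (fun i => (MvPolynomial.X (0, t 0 i) : MatrixPoly k)) hj),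
      Finset.sum_const]
    have : (Finset.Ico a (a + b + 1)).card = b + 1 := by simp; omega
    rw [this, ← Nat.cast_smul_eq_nsmul ℂ]
    push_cast
    rfl
  rw [hcard, Derivation.leibniz, hM, hL, smul_zero, add_zero, smul_eq_mul, Finset.mul_sum,
    Finset.mul_sum, ← Finset.sum_sub_distrib]
  refine Finset.sum_congr rfl fun j _ => ?_
  simp only [rowForm_apply, Finset.sum_mul, ← Finset.sum_sub_distrib]
  refine Finset.sum_congr rfl fun l _ => ?_
  simp only [MvPolynomial.smul_eq_C_mul, minorTwo]
  ring

theorem addCellPoly_mem (k a b : ℕ) (v : Fin k → ℂ) {u : MatrixPoly k}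
    (hu : u ∈ SchurModule k (twoRow (a + b + 1) a (by omega))) :
    addCellPoly k (b + 1) v u ∈ SchurModule k (twoRow (a + b + 1) (a + 1) (by omega)) := by
  refine Submodule.span_induction (p := fun u _ => addCellPoly k (b + 1) v u ∈ _)
    ?_ (by simp) (fun x y _ _ hx hy => by rw [map_add]; exact add_mem hx hy)
    (fun c x _ hx => by rw [map_smul]; exact Submodule.smul_mem _ _ hx) hu
  rintro _ ⟨t, rfl⟩
  rw [addCellPoly_fillingPoly]
  refine Submodule.sum_mem _ fun j hj => Submodule.sum_mem _ fun l _ =>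
    Submodule.smul_mem _ _ (Submodule.subset_span
      ⟨fun r i => if r = 0 then t 0 (Equiv.swap a j i) else if i = a then l else t r i, ?_⟩)
  rw [Finset.mem_Ico] at hj
  rw [fillingPoly_twoRow, Finset.prod_range_succ, mul_assoc]
  congr 1
  · refine Finset.prod_congr rfl fun i hi => ?_
    rw [Finset.mem_range] at hi
    simp [Equiv.swap_apply_of_ne_of_ne (show i ≠ a by omega) (show i ≠ j by omega),
      show i ≠ a by omega]
  · simp only [if_true, if_false, Equiv.swap_apply_left, one_ne_zero]
    congr 1
    refine Finset.prod_bij (fun i _ => Equiv.swap a j i) ?_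
      (fun _ _ _ _ h => (Equiv.swap a j).injective h) ?_ (fun _ _ => rfl)
    · intro i hi
      simp only [Finset.mem_Ico, Finset.mem_erase] at hi ⊢
      rcases eq_or_ne i j with rfl | h
      · rw [Equiv.swap_apply_right]; omega
      · rw [Equiv.swap_apply_of_ne_of_ne (by omega) h]; omega
    · intro i hi
      simp only [Finset.mem_Ico, Finset.mem_erase] at hi
      refine ⟨Equiv.swap a j i, ?_, Equiv.swap_apply_self _ _ _⟩
      simp only [Finset.mem_Ico]
      rcases eq_or_ne i a with rfl | h
      · rw [Equiv.swap_apply_left]; omega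
      · rw [Equiv.swap_apply_of_ne_of_ne h hi.1]; omega

/-- `S_μ V` for `V = ℂ³` and `μ = (a + b + 1, a)`. -/
abbrev SMu (a b : ℕ) : Submodule ℂ (MatrixPoly 3) :=
  SchurModule 3 (twoRow (a + b + 1) a (by omega))

/-- `S_ν V` for `V = ℂ³` and `ν = (a + b + 1, a + 1)`. -/
abbrev SNu (a b : ℕ) : Submodule ℂ (MatrixPoly 3) :=
  SchurModule 3 (twoRow (a + b + 1) (a + 1) (by omega))

/-- The `GL(V)`-equivariant map `φ : V → Hom(S_μ V, S_ν V)`, `φ_v(u) = P(u ⊗ v)`, where `P` is the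
projection of `S_μ V ⊗ V` to its summand `S_ν V`. As that summand has multiplicity one, the
equivariant map `P ≠ 0` is unique up to a nonzero scalar. -/
def phi (a b : ℕ) : (Fin 3 → ℂ) →ₗ[ℂ] SMu a b →ₗ[ℂ] SNu a b :=
  LinearMap.mk₂ ℂ
    (fun v u => ⟨addCellPoly 3 (b + 1) v u, addCellPoly_mem 3 a b v u.2⟩)
    (fun _ _ _ => Subtype.ext (by simp))
    (fun _ _ _ => Subtype.ext (by simp))
    (fun _ _ _ => Subtype.ext (by simp))
    (fun _ _ _ => Subtype.ext (by simp))

/-- The tensor `T_{a,b} ∈ V* ⊗ (S_μ V)* ⊗ S_ν V` that corresponds to `φ`. -/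
def Tab (a b : ℕ) : Module.Dual ℂ (Fin 3 → ℂ) ⊗[ℂ] (Module.Dual ℂ (SMu a b) ⊗[ℂ] SNu a b) :=
  (dualTensorHomEquiv ℂ (Fin 3 → ℂ) (Module.Dual ℂ (SMu a b) ⊗[ℂ] SNu a b)).symm
    ((dualTensorHomEquiv ℂ (SMu a b) (SNu a b)).symm.toLinearMap ∘ₗ phi a b)

end

/-! Identify Λ²V* with V = ℂ³ by the cross product. The flattening of `Tab a b` becomes the
transpose of a curl (S_μ V)³ → (S_ν V)³ built from the maps φ_{e_i}
(`wedgePairing_comp_koszulFlattening`), so its rank is 3m minus the dimension of the kernel of the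
curl. That kernel is zero if a = 0, and otherwise the injective image of S_{(a+b+1, a-1)} V under a
gradient of the same shape (`range_grad`, `grad_injective`). Its dimension is (b+3)a(a+b+3)/2, and
the dimension formulas for m and n turn the difference into m + n + a + b + 3.

All computations take place among polynomials in two rows of variables. Write E for `polarizeUp`, F
for `polarize` and D_j for `addCellPoly` at e_j. With the row degrees, E and F span an sl₂, and a
two-row Schur module is the space of bihomogeneous polynomials killed by E
(`schurModule_eq_hwSpace`). Dimensions follow since E is surjective between suitable bidegrees.
Exactness is a Poincaré lemma: a curl-free triple is, up to a nonzero scalar, the gradient of its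
divergence (`exact_addCellPoly`).

The border rank bound holds because a rank one tensor has a flattening of rank at most dim V* - 1 =
2 and rank is lower semicontinuous. The numerical claims rest on 2(m - n) = (a - b)(a + b + 3). -/

noncomputable section

/-! ### Border rank bound from the first Koszul flattening -/

section BorderRankBound

variable {A B C : Type*} [AddCommGroup A] [Module ℂ A] [AddCommGroup B] [Module ℂ B]
  [AddCommGroup C] [Module ℂ C]

theorem contractThird_add (S T : A ⊗[ℂ] (B ⊗[ℂ] C)) :
    contractThird (S + T) = contractThird S + contractThird T := by
  ext; simp [contractThird]

theorem contractThird_smul (c : ℂ) (T : A ⊗[ℂ] (B ⊗[ℂ] C)) :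
    contractThird (c • T) = c • contractThird T := by
  ext; simp [contractThird]

/-- The first Koszul flattening depends linearly on the tensor. -/
def koszulFlatteningHom :
    A ⊗[ℂ] (B ⊗[ℂ] C) →ₗ[ℂ] A ⊗[ℂ] Module.Dual ℂ C →ₗ[ℂ] (⋀[ℂ]^2 A) ⊗[ℂ] B where
  toFun := koszulFlattening
  map_add' S T := by
    simp [koszulFlattening, contractThird_add, LinearMap.lTensor_add, LinearMap.comp_add]
  map_smul' c T := by
    simp [koszulFlattening, contractThird_smul, LinearMap.lTensor_smul, LinearMap.comp_smul]

theorem wedgeLeft_apply (a a' : A) : wedgeLeft a a' = exteriorPower.ιMulti ℂ 2 ![a, a'] := rfl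

variable [Module.Finite ℂ A]

theorem linRank_sum_le {ι M N : Type*} [AddCommGroup M] [Module ℂ M] [AddCommGroup N]
    [Module ℂ N] [Module.Finite ℂ N] (s : Finset ι) (f : ι → M →ₗ[ℂ] N) {c : ℕ}
    (h : ∀ i ∈ s, linRank (f i) ≤ c) : linRank (∑ i ∈ s, f i) ≤ s.card * c := by
  classical
  induction s using Finset.induction_on with
  | empty =>
    rw [Finset.sum_empty, linRank, LinearMap.range_zero, finrank_bot]
    exact Nat.zero_le _
  | insert i s hi ih =>
    rw [Finset.sum_insert hi, Finset.card_insert_of_notMem hi, add_mul, one_mul, add_comm]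
    have hle : LinearMap.range (∑ j ∈ s, f j + f i) ≤
        LinearMap.range (∑ j ∈ s, f j) ⊔ LinearMap.range (f i) := by
      rintro _ ⟨x, rfl⟩
      exact Submodule.add_mem_sup ⟨x, rfl⟩ ⟨x, rfl⟩
    exact (Submodule.finrank_mono hle).trans
      ((Submodule.finrank_add_le_finrank_add_finrank _ _).trans
        (add_le_add (ih fun j hj => h j (Finset.mem_insert_of_mem hj))
          (h i (Finset.mem_insert_self _ _))))

theorem linRank_map_sum_le {r : ℕ} {E M N : Type*} [AddCommGroup E] [Module ℂ E] [AddCommGroup M]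
    [Module ℂ M] [AddCommGroup N] [Module ℂ N] [Module.Finite ℂ N] (F : E →ₗ[ℂ] M →ₗ[ℂ] N)
    (x : Fin r → E) {c : ℕ} (h : ∀ i, linRank (F (x i)) ≤ c) :
    linRank (F (∑ i, x i)) ≤ r * c := by
  rw [map_sum]
  exact (linRank_sum_le _ _ fun i _ => h i).trans (by simp)

/-- The flattening of a ⊗ b ⊗ c has its range inside that of x ↦ (x ∧ a) ⊗ b. For a ≠ 0 this map
kills a itself, which costs one dimension; for a = 0 it vanishes. -/
theorem linRank_koszulFlattening_tmul_le (a : A) (b : B) (c : C) :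
    linRank (koszulFlattening (a ⊗ₜ[ℂ] (b ⊗ₜ[ℂ] c))) ≤ Module.finrank ℂ A - 1 := by
  let g : A →ₗ[ℂ] (⋀[ℂ]^2 A) ⊗[ℂ] B := (TensorProduct.mk ℂ _ _).flip b ∘ₗ wedgeLeft.flip a
  have hle : LinearMap.range (koszulFlattening (a ⊗ₜ[ℂ] (b ⊗ₜ[ℂ] c))) ≤ LinearMap.range g := by
    rintro _ ⟨z, rfl⟩
    induction z with
    | zero => simp
    | add x y hx hy => rw [map_add]; exact add_mem hx hy
    | tmul x γ =>
      rw [koszulFlattening_tmul]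
      exact Submodule.smul_mem _ _ ⟨x, rfl⟩
  refine (Submodule.finrank_mono hle).trans ?_
  rcases eq_or_ne a 0 with rfl | ha
  · have : g = 0 := by
      ext x
      simp [g]
    rw [this, LinearMap.range_zero, finrank_bot]
    exact Nat.zero_le _
  · have hker : 0 < Module.finrank ℂ (LinearMap.ker g) := by
      rw [Module.finrank_pos_iff_exists_ne_zero]
      refine ⟨⟨a, ?_⟩, fun h => ha (congrArg Subtype.val h)⟩
      have : exteriorPower.ιMulti ℂ 2 ![a, a] = 0 :=
        (exteriorPower.ιMulti ℂ 2).map_eq_zero_of_eq ![a, a] (i := 0) (j := 1) rfl (by decide)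
      simp [g, wedgeLeft_apply, this]
    have := LinearMap.finrank_range_add_finrank_ker (V₂ := (⋀[ℂ]^2 A) ⊗[ℂ] B) g
    omega

variable [Module.Finite ℂ B] in
theorem linRank_koszulFlattening_le_of_tensorRankLE {T : A ⊗[ℂ] (B ⊗[ℂ] C)} {r : ℕ}
    (h : TensorRankLE T r) :
    linRank (koszulFlattening T) ≤ r * (Module.finrank ℂ A - 1) := by
  obtain ⟨a, b, c, hT⟩ := h
  have key := linRank_map_sum_le (M := A ⊗[ℂ] Module.Dual ℂ C) (N := (⋀[ℂ]^2 A) ⊗[ℂ] B)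
    (c := Module.finrank ℂ A - 1) koszulFlatteningHom (fun i => a i ⊗ₜ[ℂ] (b i ⊗ₜ[ℂ] c i))
  rw [hT]
  refine key ?_
  intro i
  exact linRank_koszulFlattening_tmul_le (a i) (b i) (c i)

/-- The rank is lower semicontinuous along linear families of linear maps. -/
theorem eventually_linRank_le {E M N : Type*} [AddCommGroup E] [Module ℂ E] [AddCommGroup M]
    [Module ℂ M] [AddCommGroup N] [Module ℂ N] [Module.Finite ℂ N]
    (F : E →ₗ[ℂ] M →ₗ[ℂ] N) (T : E) :
    ∀ᶠ S in @nhds _ (moduleTopology ℂ E) T, linRank (F T) ≤ linRank (F S) := by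
  let _ := moduleTopology ℂ E
  have : IsModuleTopology ℂ E := ⟨rfl⟩
  -- Preimages `x` of a basis of the range of `F T` are kept fixed. Linear independence of the
  -- vectors `F S (x i)` is an open condition on `S` that holds at `T`, and it bounds the rank of `F
  -- S` from below.
  let bas := Module.finBasis ℂ (LinearMap.range (F T))
  choose x hx using fun i => (bas i).2
  let e := (Module.finBasis ℂ N).equivFun
  let G : E →ₗ[ℂ] (Fin (Module.finrank ℂ (LinearMap.range (F T))) →
      Fin (Module.finrank ℂ N) → ℂ) :=
    LinearMap.pi fun i => e.toLinearMap ∘ₗ F.flip (x i)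
  have hG : Continuous G := IsModuleTopology.continuous_of_linearMap G
  have hind : ∀ S, LinearIndependent ℂ (G S) ↔ LinearIndependent ℂ fun i => F S (x i) := fun S =>
    e.toLinearMap.linearIndependent_iff (v := fun i => F S (x i)) (LinearEquiv.ker e)
  have hT : LinearIndependent ℂ (G T) := by
    rw [hind]
    simp_rw [hx]
    exact bas.linearIndependent.map' (Submodule.subtype _) (Submodule.ker_subtype _)
  have hopen := (isOpen_setOfPred_linearIndependent (𝕜 := ℂ)
    (ι := Fin (Module.finrank ℂ (LinearMap.range (F T))))
    (E := Fin (Module.finrank ℂ N) → ℂ)).preimage hG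
  filter_upwards [hopen.mem_nhds hT] with S hS
  have hS' : LinearIndependent ℂ fun i => F S (x i) := (hind S).1 hS
  have hS'' : LinearIndependent ℂ fun i => (⟨F S (x i), x i, rfl⟩ : LinearMap.range (F S)) :=
    LinearIndependent.of_comp (Submodule.subtype _) hS'
  simpa [linRank] using hS''.fintype_card_le_finrank

variable [Module.Finite ℂ B] in
/-- The border rank lower bound given by the first Koszul flattening. -/
theorem linRank_koszulFlattening_le (T : A ⊗[ℂ] (B ⊗[ℂ] C)) :
    linRank (koszulFlattening T) ≤ borderRank T * (Module.finrank ℂ A - 1) := by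
  -- The infimum is attained because the set is nonempty. By semicontinuity one approximant of rank
  -- at most `borderRank T` already has a flattening of rank at least that of `T`.
  obtain ⟨S, hS, hlim⟩ : BorderRankLE T (borderRank T) := Nat.sInf_mem (exists_borderRankLE T)
  obtain ⟨k, hk⟩ := (hlim.eventually (eventually_linRank_le
    (M := A ⊗[ℂ] Module.Dual ℂ C) (N := (⋀[ℂ]^2 A) ⊗[ℂ] B) koszulFlatteningHom T)).exists
  exact hk.trans (linRank_koszulFlattening_le_of_tensorRankLE (hS k))

end BorderRankBound

/-! ### Bidegree and the sl₂ of polarizations -/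

section Bidegree

open MvPolynomial

/-- The multidegree of the variable `Z_{r,j}` with respect to the rows. -/
def rowWeight (k : ℕ) (p : ℕ × Fin k) : ℕ →₀ ℕ := Finsupp.single p.1 1

/-- The row degrees of a polynomial of degree `s` in row `0` and `t` in row `1`. -/
def bideg (s t : ℕ) : ℕ →₀ ℕ := Finsupp.single 0 s + Finsupp.single 1 t

/-- Polynomials of degree `s` in the variables of row `0` and of degree `t` in those of row `1`,
which contain no further variables. -/
def biHom (k s t : ℕ) : Submodule ℂ (MatrixPoly k) :=
  weightedHomogeneousSubmodule ℂ (rowWeight k) (bideg s t)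

theorem mem_biHom {k s t : ℕ} {f : MatrixPoly k} :
    f ∈ biHom k s t ↔ IsWeightedHomogeneous (rowWeight k) f (bideg s t) := Iff.rfl

theorem biHom_mul {k s t s' t' : ℕ} {f g : MatrixPoly k} (hf : f ∈ biHom k s t)
    (hg : g ∈ biHom k s' t') : f * g ∈ biHom k (s + s') (t + t') := by
  have h : bideg (s + s') (t + t') = bideg s t + bideg s' t' := by
    simp only [bideg, Finsupp.single_add]; abel
  rw [mem_biHom, h]
  exact IsWeightedHomogeneous.mul hf hg

theorem X_zero_mem_biHom {k : ℕ} (j : Fin k) : (X (0, j) : MatrixPoly k) ∈ biHom k 1 0 := by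
  have : bideg 1 0 = rowWeight k (0, j) := by simp [bideg, rowWeight]
  rw [mem_biHom, this]
  exact isWeightedHomogeneous_X ℂ _ _

theorem X_one_mem_biHom {k : ℕ} (j : Fin k) : (X (1, j) : MatrixPoly k) ∈ biHom k 0 1 := by
  have : bideg 0 1 = rowWeight k (1, j) := by simp [bideg, rowWeight]
  rw [mem_biHom, this]
  exact isWeightedHomogeneous_X ℂ _ _

theorem X_zero_mul_mem {k s t : ℕ} {f : MatrixPoly k} (hf : f ∈ biHom k s t) (j : Fin k) :
    X (0, j) * f ∈ biHom k (s + 1) t := by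
  simpa [add_comm] using biHom_mul (X_zero_mem_biHom j) hf

theorem X_one_mul_mem {k s t : ℕ} {f : MatrixPoly k} (hf : f ∈ biHom k s t) (j : Fin k) :
    X (1, j) * f ∈ biHom k s (t + 1) := by
  simpa [add_comm] using biHom_mul (X_one_mem_biHom j) hf

theorem weight_rowWeight_apply {k : ℕ} (d : ℕ × Fin k →₀ ℕ) (r : ℕ) :
    Finsupp.weight (rowWeight k) d r = ∑ j, d (r, j) := by
  classical
  induction d using Finsupp.induction_linear with
  | zero => simp
  | add d e hd he => simp [hd, he, Finset.sum_add_distrib]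
  | single p n =>
    obtain ⟨q, i⟩ := p
    by_cases h : q = r
    · subst h
      simp [Finsupp.weight_single, rowWeight, Finsupp.single_apply]
    · simp [Finsupp.weight_single, rowWeight, h]

theorem pderiv_isWeightedHomogeneous {k : ℕ} {f : MatrixPoly k} {w w' : ℕ →₀ ℕ} {p : ℕ × Fin k}
    (hf : IsWeightedHomogeneous (rowWeight k) f w) (h : w' + rowWeight k p = w) :
    IsWeightedHomogeneous (rowWeight k) (pderiv p f) w' := by
  induction hf using IsWeightedHomogeneous.induction_on with
  | zero => simpa using isWeightedHomogeneous_zero ℂ _ _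
  | add x y _ _ hx hy => rw [map_add]; exact hx.add hy
  | monomial d c hd =>
    rw [pderiv_monomial]
    -- If `p` does not occur, the truncated exponent would have the wrong weight, but then the
    -- coefficient is zero.
    by_cases h0 : d p = 0
    · simpa [h0] using isWeightedHomogeneous_zero ℂ _ _
    · refine isWeightedHomogeneous_monomial _ _ _ (add_right_cancel (b := rowWeight k p) ?_)
      have hle : Finsupp.single p 1 ≤ d := by
        rw [Finsupp.single_le_iff]; omega
      rw [h, ← hd, ← tsub_add_cancel_of_le hle, map_add, Finsupp.weight_single, one_smul,
        tsub_add_cancel_of_le hle]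

theorem pderiv_zero_mem {k s t : ℕ} {f : MatrixPoly k} (hf : f ∈ biHom k (s + 1) t) (j : Fin k) :
    pderiv (0, j) f ∈ biHom k s t := by
  refine pderiv_isWeightedHomogeneous (mem_biHom.1 hf) ?_
  simp only [bideg, rowWeight, Finsupp.single_add]; abel

theorem pderiv_one_mem {k s t : ℕ} {f : MatrixPoly k} (hf : f ∈ biHom k s (t + 1)) (j : Fin k) :
    pderiv (1, j) f ∈ biHom k s t := by
  refine pderiv_isWeightedHomogeneous (mem_biHom.1 hf) ?_
  simp only [bideg, rowWeight, Finsupp.single_add]; abel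

/-- The polarization derivation `∑_j Z_{0,j} ∂/∂Z_{1,j}`. -/
def polarizeUp (k : ℕ) : Derivation ℂ (MatrixPoly k) (MatrixPoly k) :=
  mkDerivation ℂ fun p => if p.1 = 1 then X (0, p.2) else 0

/-- The Euler derivation of row `r`. -/
def rowEuler (k r : ℕ) : Derivation ℂ (MatrixPoly k) (MatrixPoly k) :=
  mkDerivation ℂ fun p => if p.1 = r then X p else 0

theorem sum_smul_pderiv_X {k : ℕ} (r : ℕ) (g : Fin k → MatrixPoly k) (p : ℕ × Fin k) :
    (∑ j, g j • (pderiv (r, j) : Derivation ℂ (MatrixPoly k) (MatrixPoly k))) (X p) =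
      if p.1 = r then g p.2 else 0 := by
  obtain ⟨q, i⟩ := p
  rw [← Derivation.coeFnAddMonoidHom_apply, map_sum, Finset.sum_apply]
  by_cases h : q = r
  · subst h
    rw [if_pos rfl, Finset.sum_eq_single i]
    · simp
    · intro j _ hj
      simp [pderiv_X, hj.symm]
    · simp
  · rw [if_neg h]
    refine Finset.sum_eq_zero fun j _ => ?_
    simp [pderiv_X, h]

theorem sum_smul_derivation_apply {k : ℕ} {ι : Type*} (s : Finset ι) (g : ι → MatrixPoly k)
    (d : ι → Derivation ℂ (MatrixPoly k) (MatrixPoly k)) (f : MatrixPoly k) :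
    (∑ j ∈ s, g j • d j) f = ∑ j ∈ s, g j * d j f := by
  rw [← Derivation.coeFnAddMonoidHom_apply, map_sum, Finset.sum_apply]
  rfl

theorem polarize_apply {k : ℕ} (f : MatrixPoly k) :
    polarize k f = ∑ j, X (1, j) * pderiv (0, j) f := by
  rw [← sum_smul_derivation_apply]
  congr 1
  refine derivation_ext fun p => ?_
  rw [sum_smul_pderiv_X, polarize, mkDerivation_X]

theorem polarizeUp_apply {k : ℕ} (f : MatrixPoly k) :
    polarizeUp k f = ∑ j, X (0, j) * pderiv (1, j) f := by
  rw [← sum_smul_derivation_apply]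
  congr 1
  refine derivation_ext fun p => ?_
  rw [sum_smul_pderiv_X, polarizeUp, mkDerivation_X]

theorem rowEuler_apply {k : ℕ} (r : ℕ) (f : MatrixPoly k) :
    rowEuler k r f = ∑ j, X (r, j) * pderiv (r, j) f := by
  rw [← sum_smul_derivation_apply]
  congr 1
  refine derivation_ext fun p => ?_
  rw [sum_smul_pderiv_X, rowEuler, mkDerivation_X]
  obtain ⟨q, i⟩ := p
  split_ifs with h
  · simp only at h; rw [h]
  · rfl

theorem rowEuler_of_isWeightedHomogeneous {k : ℕ} (r : ℕ) {f : MatrixPoly k} {w : ℕ →₀ ℕ}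
    (hf : IsWeightedHomogeneous (rowWeight k) f w) : rowEuler k r f = (w r : ℂ) • f := by
  induction hf using IsWeightedHomogeneous.induction_on with
  | zero => simp
  | add x y _ _ hx hy => rw [map_add, hx, hy, smul_add]
  | monomial d c hd =>
    rw [rowEuler_apply]
    simp_rw [X_mul_pderiv_monomial]
    rw [← Finset.sum_smul, ← hd, weight_rowWeight_apply, Nat.cast_smul_eq_nsmul]

theorem rowEuler_zero_of_mem {k s t : ℕ} {f : MatrixPoly k} (hf : f ∈ biHom k s t) :
    rowEuler k 0 f = (s : ℂ) • f := by
  rw [rowEuler_of_isWeightedHomogeneous 0 hf]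
  simp [bideg]

theorem rowEuler_one_of_mem {k s t : ℕ} {f : MatrixPoly k} (hf : f ∈ biHom k s t) :
    rowEuler k 1 f = (t : ℂ) • f := by
  rw [rowEuler_of_isWeightedHomogeneous 1 hf]
  simp [bideg]

theorem polarize_mem {k s t : ℕ} {f : MatrixPoly k} (hf : f ∈ biHom k (s + 1) t) :
    polarize k f ∈ biHom k s (t + 1) := by
  rw [polarize_apply]
  exact Submodule.sum_mem _ fun j _ => X_one_mul_mem (pderiv_zero_mem hf j) j

theorem polarizeUp_mem {k s t : ℕ} {f : MatrixPoly k} (hf : f ∈ biHom k s (t + 1)) :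
    polarizeUp k f ∈ biHom k (s + 1) t := by
  rw [polarizeUp_apply]
  exact Submodule.sum_mem _ fun j _ => X_zero_mul_mem (pderiv_one_mem hf j) j

/-- The relation [E, F] = H of sl₂, with H the difference of the row degrees. Both sides are
derivations, so it suffices to compare them on variables. -/
theorem polarizeUp_polarize {k : ℕ} (f : MatrixPoly k) :
    polarizeUp k (polarize k f) =
      polarize k (polarizeUp k f) + rowEuler k 0 f - rowEuler k 1 f := by
  have : ⁅polarizeUp k, polarize k⁆ = rowEuler k 0 - rowEuler k 1 := by
    refine derivation_ext fun p => ?_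
    obtain ⟨q, i⟩ := p
    by_cases h0 : q = 0
    · subst h0; simp [Derivation.commutator_apply, polarize, polarizeUp, rowEuler]
    · by_cases h1 : q = 1
      · subst h1; simp [Derivation.commutator_apply, polarize, polarizeUp, rowEuler]
      · simp [Derivation.commutator_apply, polarize, polarizeUp, rowEuler, h0, h1]
  have h := DFunLike.congr_fun this f
  rw [Derivation.commutator_apply, Derivation.sub_apply] at h
  rw [add_sub_assoc, ← h]; abel

theorem pderiv_one_polarize {k : ℕ} (j : Fin k) (f : MatrixPoly k) :
    pderiv (1, j) (polarize k f) = polarize k (pderiv (1, j) f) + pderiv (0, j) f := by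
  have : ⁅(pderiv (1, j) : Derivation ℂ (MatrixPoly k) (MatrixPoly k)), polarize k⁆ =
      pderiv (0, j) := by
    refine derivation_ext fun p => ?_
    obtain ⟨q, i⟩ := p
    by_cases h0 : q = 0
    · subst h0
      by_cases hi : i = j <;>
        simp [Derivation.commutator_apply, polarize, pderiv_X, hi]
    · by_cases h1 : (q, i) = (1, j) <;>
        simp [Derivation.commutator_apply, polarize, pderiv_X, h0, h1]
  have h := DFunLike.congr_fun this f
  rw [Derivation.commutator_apply] at h
  rw [← h]; abel

/-- The coefficients of E involve only row 0, so differentiating by a row 1 variable commutes with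
E. Such derivatives therefore preserve highest weight vectors. -/
theorem pderiv_one_polarizeUp {k : ℕ} (j : Fin k) (f : MatrixPoly k) :
    pderiv (1, j) (polarizeUp k f) = polarizeUp k (pderiv (1, j) f) := by
  have : ⁅(pderiv (1, j) : Derivation ℂ (MatrixPoly k) (MatrixPoly k)), polarizeUp k⁆ = 0 := by
    refine derivation_ext fun p => ?_
    obtain ⟨q, i⟩ := p
    by_cases h0 : q = 1
    · subst h0
      by_cases hi : i = j <;>
        simp [Derivation.commutator_apply, polarizeUp, pderiv_X, hi]
    · by_cases h1 : (q, i) = (1, j) <;>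
        simp [Derivation.commutator_apply, polarizeUp, pderiv_X, h0, h1]
  have h := DFunLike.congr_fun this f
  rw [Derivation.commutator_apply] at h
  exact sub_eq_zero.1 h

theorem biHom_zero_zero {k : ℕ} {f : MatrixPoly k} (hf : f ∈ biHom k 0 0) :
    ∃ c : ℂ, f = C c := by
  refine ⟨coeff 0 f, ?_⟩
  ext d
  rw [coeff_C]
  split_ifs with h
  · rw [h]
  · by_contra hd
    have hw := mem_biHom.1 hf hd
    refine h (Finsupp.ext fun p => ?_)
    have := weight_rowWeight_apply d p.1
    rw [hw] at this
    simp only [bideg, Finsupp.single_zero, add_zero, Finsupp.coe_zero, Pi.zero_apply] at this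
    exact ((Finset.sum_eq_zero_iff.1 this.symm) p.2 (Finset.mem_univ _)).symm

theorem pderiv_eq_zero {k : ℕ} {f : MatrixPoly k} {w : ℕ →₀ ℕ} {p : ℕ × Fin k}
    (hf : IsWeightedHomogeneous (rowWeight k) f w) (h : w p.1 = 0) : pderiv p f = 0 := by
  induction hf using IsWeightedHomogeneous.induction_on with
  | zero => simp
  | add x y _ _ hx hy => rw [map_add, hx, hy, add_zero]
  | monomial d c hd =>
    rw [← hd, weight_rowWeight_apply] at h
    have : d p = 0 := Finset.sum_eq_zero_iff.1 h p.2 (Finset.mem_univ _)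
    simp [pderiv_monomial, this]

theorem pderiv_one_eq_zero {k s : ℕ} {f : MatrixPoly k} (hf : f ∈ biHom k s 0) (j : Fin k) :
    pderiv (1, j) f = 0 :=
  pderiv_eq_zero hf (by simp [bideg])

end Bidegree

/-! ### Schur modules as highest weight spaces -/

section HighestWeight

open MvPolynomial

theorem rowEuler_zero_eq {k s t : ℕ} {f : MatrixPoly k} (hf : f ∈ biHom k s t) :
    ∑ j, X (0, j) * pderiv (0, j) f = (s : MatrixPoly k) * f := by
  rw [← rowEuler_apply, rowEuler_zero_of_mem hf, Nat.cast_smul_eq_nsmul, nsmul_eq_mul]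

theorem rowEuler_one_eq {k s t : ℕ} {f : MatrixPoly k} (hf : f ∈ biHom k s t) :
    ∑ j, X (1, j) * pderiv (1, j) f = (t : MatrixPoly k) * f := by
  rw [← rowEuler_apply, rowEuler_one_of_mem hf, Nat.cast_smul_eq_nsmul, nsmul_eq_mul]

theorem polarizeUp_polarize_of_mem {k s t : ℕ} {f : MatrixPoly k} (hf : f ∈ biHom k s t) :
    polarizeUp k (polarize k f) =
      polarize k (polarizeUp k f) + (s : MatrixPoly k) * f - (t : MatrixPoly k) * f := by
  rw [polarizeUp_polarize, rowEuler_apply, rowEuler_apply, rowEuler_zero_eq hf,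
    rowEuler_one_eq hf]

/-- The polynomials of bidegree `(s, t)` killed by `∑_j Z_{0,j} ∂/∂Z_{1,j}`. -/
def hwSpace (k s t : ℕ) : Submodule ℂ (MatrixPoly k) :=
  biHom k s t ⊓ LinearMap.ker (polarizeUp k).toLinearMap

theorem mem_hwSpace {k s t : ℕ} {f : MatrixPoly k} :
    f ∈ hwSpace k s t ↔ f ∈ biHom k s t ∧ polarizeUp k f = 0 := Iff.rfl

theorem hwSpace_mul {k s t s' t' : ℕ} {f g : MatrixPoly k} (hf : f ∈ hwSpace k s t)
    (hg : g ∈ hwSpace k s' t') : f * g ∈ hwSpace k (s + s') (t + t') := by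
  rw [mem_hwSpace] at *
  refine ⟨biHom_mul hf.1 hg.1, ?_⟩
  rw [Derivation.leibniz, hf.2, hg.2, smul_zero, smul_zero, add_zero]

theorem one_mem_hwSpace (k : ℕ) : (1 : MatrixPoly k) ∈ hwSpace k 0 0 := by
  refine mem_hwSpace.2 ⟨?_, by simp⟩
  have : bideg 0 0 = 0 := by simp [bideg]
  rw [mem_biHom, this]
  exact isWeightedHomogeneous_one ℂ _

theorem X_zero_mem_hwSpace {k : ℕ} (j : Fin k) : (X (0, j) : MatrixPoly k) ∈ hwSpace k 1 0 :=
  mem_hwSpace.2 ⟨X_zero_mem_biHom j, by simp [polarizeUp]⟩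

theorem minorTwo_mem_hwSpace {k : ℕ} (i j : Fin k) : minorTwo i j ∈ hwSpace k 1 1 := by
  have hX : ∀ i j : Fin k, X (0, i) * X (1, j) ∈ biHom k 1 1 := fun i j => by
    simpa using X_zero_mul_mem (X_one_mem_biHom j) i
  refine mem_hwSpace.2 ⟨Submodule.sub_mem _ (hX i j) (hX j i), ?_⟩
  have h0 : ∀ i : Fin k, polarizeUp k (X (0, i)) = 0 := fun i => by simp [polarizeUp]
  have h1 : ∀ i : Fin k, polarizeUp k (X (1, i)) = X (0, i) := fun i => by simp [polarizeUp]
  rw [minorTwo, map_sub, Derivation.leibniz, Derivation.leibniz, h0, h0, h1, h1, smul_zero,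
    smul_zero, smul_eq_mul, smul_eq_mul]
  ring

theorem hwSpace_prod {k s t : ℕ} (S : Finset ℕ) {f : ℕ → MatrixPoly k}
    (hf : ∀ j ∈ S, f j ∈ hwSpace k s t) : ∏ j ∈ S, f j ∈ hwSpace k (S.card * s) (S.card * t) := by
  classical
  induction S using Finset.induction_on with
  | empty => simpa using one_mem_hwSpace k
  | insert i S hi ih =>
    rw [Finset.prod_insert hi, Finset.card_insert_of_notMem hi, add_mul, add_mul, one_mul, one_mul,
      add_comm _ s, add_comm _ t]
    exact hwSpace_mul (hf i (Finset.mem_insert_self _ _))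
      (ih fun j hj => hf j (Finset.mem_insert_of_mem hj))

/-- Minors on the two rows and variables of row 0 are killed by the derivation E, hence so are their
products. -/
theorem schurModule_le_hwSpace {k s t : ℕ} (h : t ≤ s) :
    SchurModule k (twoRow s t h) ≤ hwSpace k s t := by
  refine Submodule.span_le.2 ?_
  rintro _ ⟨τ, rfl⟩
  rw [fillingPoly_twoRow]
  have := hwSpace_mul
    (hwSpace_prod (Finset.range t) fun j _ => minorTwo_mem_hwSpace (τ 0 j) (τ 1 j))
    (hwSpace_prod (Finset.Ico t s) fun j _ => X_zero_mem_hwSpace (τ 0 j))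
  simpa [Nat.add_sub_cancel' h] using this

theorem pderiv_one_mem_hwSpace {k s t : ℕ} {f : MatrixPoly k} (hf : f ∈ hwSpace k s (t + 1))
    (j : Fin k) : pderiv (1, j) f ∈ hwSpace k s t := by
  rw [mem_hwSpace] at *
  exact ⟨pderiv_one_mem hf.1 j, by rw [← pderiv_one_polarizeUp, hf.2, map_zero]⟩

/-- Scalars appear as naturals cast into the polynomial ring, so that later identities are plain
ring identities. -/
theorem addCellPoly_single {k : ℕ} (c : ℕ) (j : Fin k) (f : MatrixPoly k) :
    addCellPoly k c (Pi.single j 1) f =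
      (c : MatrixPoly k) * (X (1, j) * f) - X (0, j) * polarize k f := by
  have h : ∀ r, rowForm r (Pi.single j 1) = (X (r, j) : MatrixPoly k) := fun r => by
    simp [rowForm_apply, Pi.single_apply]
  rw [addCellPoly_apply, h, h, Nat.cast_smul_eq_nsmul, nsmul_eq_mul]

/-- Adding a cell to the second row after removing one in all ways is a scalar operator. -/
theorem sum_addCellPoly_pderiv {k a b : ℕ} {f : MatrixPoly k}
    (hf : f ∈ hwSpace k (a + b + 1) (a + 1)) :
    ∑ j, addCellPoly k (b + 1 : ℕ) (Pi.single j 1) (pderiv (1, j) f) =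
      (((a + 1) * (b + 2) : ℕ) : MatrixPoly k) * f := by
  rw [mem_hwSpace] at hf
  have h0 := rowEuler_zero_eq hf.1
  have h1 := rowEuler_one_eq hf.1
  have h2 := polarizeUp_polarize_of_mem hf.1
  rw [hf.2, map_zero, polarizeUp_apply] at h2
  -- Moving F past ∂_{1,j} leaves the row Euler operators and EF, which acts on `f` as the scalar b.
  -- The total is (b+1)(a+1) - b + (a+b+1) = (a+1)(b+2).
  have h3 : ∀ j, polarize k (pderiv (1, j) f) =
      pderiv (1, j) (polarize k f) - pderiv (0, j) f := fun j => by
    rw [pderiv_one_polarize]; abel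
  simp only [addCellPoly_single, h3, mul_sub, Finset.sum_sub_distrib, ← Finset.mul_sum, h0, h1, h2]
  push_cast
  ring

theorem natCast_mul_mem_iff {k n : ℕ} (hn : n ≠ 0) (U : Submodule ℂ (MatrixPoly k))
    {f : MatrixPoly k} : (n : MatrixPoly k) * f ∈ U ↔ f ∈ U := by
  rw [← nsmul_eq_mul, ← Nat.cast_smul_eq_nsmul ℂ]
  exact U.smul_mem_iff (Nat.cast_ne_zero.2 hn)

theorem X_mul_mem_schurModule {k s : ℕ} {f : MatrixPoly k}
    (hf : f ∈ SchurModule k (twoRow s 0 (Nat.zero_le _))) (j : Fin k) :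
    X (0, j) * f ∈ SchurModule k (twoRow (s + 1) 0 (Nat.zero_le _)) := by
  refine Submodule.span_induction (p := fun f _ => X (0, j) * f ∈ _) ?_ (by simp)
    (fun x y _ _ hx hy => by rw [mul_add]; exact add_mem hx hy)
    (fun c x _ hx => by rw [mul_smul_comm]; exact Submodule.smul_mem _ _ hx) hf
  rintro _ ⟨τ, rfl⟩
  refine Submodule.subset_span ⟨fun r i => if i = s then j else τ r i, ?_⟩
  rw [fillingPoly_twoRow, fillingPoly_twoRow]
  simp only [Finset.range_zero, Finset.prod_empty, one_mul, ← Finset.range_eq_Ico]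
  rw [Finset.prod_range_succ, if_pos rfl, mul_comm]
  congr 1
  refine Finset.prod_congr rfl fun i hi => ?_
  rw [if_neg (Finset.mem_range.1 hi).ne]

/-- Induction on the degree by Euler's identity, which recovers a polynomial from its partial
derivatives. -/
theorem biHom_le_schurModule {k : ℕ} [NeZero k] (s : ℕ) :
    biHom k s 0 ≤ SchurModule k (twoRow s 0 (Nat.zero_le _)) := by
  induction s with
  | zero =>
    intro f hf
    obtain ⟨c, rfl⟩ := biHom_zero_zero hf
    rw [← mul_one (C c), ← smul_eq_C_mul]
    -- The empty diagram contributes the constant 1, but a filling must exist; this uses that k is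
    -- nonzero.
    refine Submodule.smul_mem _ _ (Submodule.subset_span ⟨fun _ _ => 0, ?_⟩)
    rw [fillingPoly_twoRow]
    simp
  | succ s ih =>
    intro f hf
    rw [← natCast_mul_mem_iff (Nat.succ_ne_zero s), ← rowEuler_zero_eq hf]
    exact Submodule.sum_mem _ fun j _ => X_mul_mem_schurModule (ih (pderiv_zero_mem hf j)) j

/-- Induction on the length of the second row. By `sum_addCellPoly_pderiv` a highest weight vector
is a nonzero multiple of a sum of D_j applied to its derivatives ∂_{1,j}, which lie in the Schur
module with one cell less. -/
theorem hwSpace_le_schurModule {k : ℕ} [NeZero k] (t s : ℕ) (h : t ≤ s) :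
    hwSpace k s t ≤ SchurModule k (twoRow s t h) := by
  induction t generalizing s with
  | zero => exact inf_le_left.trans (biHom_le_schurModule s)
  | succ t ih =>
    intro f hf
    obtain ⟨b, rfl⟩ : ∃ b, s = t + b + 1 := ⟨s - t - 1, by omega⟩
    have hn : (t + 1) * (b + 2) ≠ 0 := by positivity
    rw [← natCast_mul_mem_iff hn, ← sum_addCellPoly_pderiv hf]
    refine Submodule.sum_mem _ fun j _ => ?_
    have := addCellPoly_mem k t b (Pi.single j 1)
      (ih _ (by omega) (pderiv_one_mem_hwSpace hf j))
    exact_mod_cast this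

/-- The Schur module of a partition with two rows consists of the highest weight vectors for the
action of `GL_2` on the rows. -/
theorem schurModule_eq_hwSpace {k s t : ℕ} [NeZero k] (h : t ≤ s) :
    SchurModule k (twoRow s t h) = hwSpace k s t :=
  le_antisymm (schurModule_le_hwSpace h) (hwSpace_le_schurModule t s h)

theorem addCellPoly_mem_hwSpace {k s t b : ℕ} [NeZero k] (hb : s = t + b + 1) (v : Fin k → ℂ)
    {f : MatrixPoly k} (hf : f ∈ hwSpace k s t) :
    addCellPoly k (b + 1 : ℕ) v f ∈ hwSpace k s (t + 1) := by
  subst hb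
  rw [← schurModule_eq_hwSpace (by omega)] at hf ⊢
  exact_mod_cast addCellPoly_mem k t b v hf

/-! ### Dimensions -/

/-- FE has no negative integer eigenvalue on these bidegrees. Applying E to FEf + cf = 0 gives an
equation of the same form for Ef, with a larger constant and a smaller `t`, so Ef = 0 by induction
and then cf = 0. -/
theorem eq_zero_of_polarize_polarizeUp_add {k : ℕ} (t : ℕ) : ∀ {s c : ℕ} {f : MatrixPoly k},
    t ≤ s → f ∈ biHom k s t → c ≠ 0 →
    polarize k (polarizeUp k f) + (c : MatrixPoly k) * f = 0 → f = 0 := by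
  have cancel : ∀ {c : ℕ} {f : MatrixPoly k}, c ≠ 0 → (c : MatrixPoly k) * f = 0 → f = 0 :=
    fun hc h => (mul_eq_zero.1 h).resolve_left (Nat.cast_ne_zero.2 hc)
  induction t with
  | zero =>
    intro s c f _ hf hc h
    have : polarizeUp k f = 0 := by
      rw [polarizeUp_apply]
      exact Finset.sum_eq_zero fun j _ => by rw [pderiv_one_eq_zero hf, mul_zero]
    rw [this, map_zero, zero_add] at h
    exact cancel hc h
  | succ t ih =>
    intro s c f hts hf hc h
    obtain ⟨e, rfl⟩ : ∃ e, s = t + 1 + e := ⟨s - (t + 1), by omega⟩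
    have hg := polarizeUp_mem hf
    have hg0 : polarizeUp k f = 0 := by
      -- On bidegree (s + 1, t) one has EF = FE + (s + 1 - t), and s + 1 - t = e + 2.
      refine ih (c := c + e + 2) (by omega) hg (by omega) ?_
      have h' := congrArg (polarizeUp k) h
      rw [map_add, polarizeUp_polarize_of_mem hg, Derivation.leibniz, Derivation.map_natCast,
        map_zero, smul_zero, add_zero, smul_eq_mul] at h'
      rw [← h']
      push_cast
      ring
    rw [hg0, map_zero, zero_add] at h
    exact cancel hc h

/-- Exponents of bidegree `(s, t)` are pairs of exponents of degrees `s` and `t`. -/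
def bidegEquiv (k s t : ℕ) : {d : ℕ × Fin k →₀ ℕ | Finsupp.weight (rowWeight k) d = bideg s t} ≃
    Sym (Fin k) s × Sym (Fin k) t :=
  Equiv.trans (β := {P : Fin k → ℕ // ∑ i, P i = s} × {P : Fin k → ℕ // ∑ i, P i = t})
    { toFun := fun d =>
        (⟨fun j => d.1 (0, j), by
          rw [← weight_rowWeight_apply, show Finsupp.weight (rowWeight k) d.1 = _ from d.2]
          simp [bideg]⟩,
        ⟨fun j => d.1 (1, j), by
          rw [← weight_rowWeight_apply, show Finsupp.weight (rowWeight k) d.1 = _ from d.2]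
          simp [bideg]⟩)
      invFun := fun P =>
        ⟨Finsupp.onFinset (Finset.range 2 ×ˢ Finset.univ)
          (fun p => if p.1 = 0 then P.1.1 p.2 else if p.1 = 1 then P.2.1 p.2 else 0) (by
            rintro ⟨r, i⟩ h
            simp only [Finset.mem_product, Finset.mem_range, Finset.mem_univ, and_true]
            by_contra hr
            simp [show r ≠ 0 by omega, show r ≠ 1 by omega] at h), by
          refine Finsupp.ext fun r => ?_
          rw [weight_rowWeight_apply]
          by_cases h0 : r = 0
          · subst h0; simp [bideg, P.1.2]
          · by_cases h1 : r = 1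
            · subst h1; simp [bideg, P.2.2]
            · simp [bideg, h0, h1]⟩
      left_inv := fun d => by
        refine Subtype.ext (Finsupp.ext ?_)
        rintro ⟨r, i⟩
        by_cases h0 : r = 0
        · subst h0; simp
        · by_cases h1 : r = 1
          · subst h1; simp
          · have h := weight_rowWeight_apply d.1 r
            rw [show Finsupp.weight (rowWeight k) d.1 = _ from d.2] at h
            have h' : (bideg s t) r = 0 := by simp [bideg, h0, h1]
            rw [h'] at h
            simpa [h0, h1] using
              (Finset.sum_eq_zero_iff.1 h.symm i (Finset.mem_univ _)).symm
      right_inv := fun P => by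
        refine Prod.ext (Subtype.ext (funext fun j => ?_)) (Subtype.ext (funext fun j => ?_)) <;>
          simp }
    ((Sym.equivNatSumOfFintype _ _).symm.prodCongr (Sym.equivNatSumOfFintype _ _).symm)

/-- The monomial basis, indexed by pairs of multisets. -/
def biHomBasis (k s t : ℕ) : Module.Basis (Sym (Fin k) s × Sym (Fin k) t) ℂ (biHom k s t) :=
  ((basisRestrictSupport ℂ _).map (LinearEquiv.ofEq _ _
    (weightedHomogeneousSubmodule_eq_finsupp_supported _ _ _).symm)).reindex (bidegEquiv k s t)

instance biHom_finite (k s t : ℕ) : Module.Finite ℂ (biHom k s t) :=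
  Module.Finite.of_basis (biHomBasis k s t)

theorem finrank_biHom (s t : ℕ) :
    Module.finrank ℂ (biHom 3 s t) = (s + 2).choose 2 * (t + 2).choose 2 := by
  have h : ∀ n, (3 + n - 1).choose n = (n + 2).choose 2 := fun n => by
    rw [show 3 + n - 1 = 2 + n by omega, Nat.choose_symm_add.symm, add_comm]
  rw [Module.finrank_eq_card_basis (biHomBasis 3 s t), Fintype.card_prod,
    Sym.card_sym_eq_choose, Sym.card_sym_eq_choose, Fintype.card_fin, h, h]

/-- EF is injective on the target, where it equals FE plus the positive integer s + 1 - t. By finite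
dimension it is surjective, and hence so is E. -/
theorem exists_polarizeUp_eq {k s t : ℕ} (h : t ≤ s) {g : MatrixPoly k}
    (hg : g ∈ biHom k (s + 1) t) : ∃ f ∈ biHom k s (t + 1), polarizeUp k f = g := by
  let L : biHom k (s + 1) t →ₗ[ℂ] biHom k (s + 1) t :=
    ((polarizeUp k).toLinearMap ∘ₗ (polarize k).toLinearMap).restrict
      fun f hf => polarizeUp_mem (polarize_mem hf)
  have hL : Function.Injective L := by
    rw [← LinearMap.ker_eq_bot, LinearMap.ker_eq_bot']
    rintro ⟨f, hf⟩ h0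
    have h0' : polarizeUp k (polarize k f) = 0 := congrArg Subtype.val h0
    obtain ⟨e, rfl⟩ : ∃ e, s = t + e := ⟨s - t, by omega⟩
    refine Subtype.ext (eq_zero_of_polarize_polarizeUp_add t (c := e + 1) (by omega) hf
      (by omega) ?_)
    rw [polarizeUp_polarize_of_mem hf] at h0'
    rw [← h0']
    push_cast
    ring
  obtain ⟨f, hf⟩ := LinearMap.injective_iff_surjective.1 hL ⟨g, hg⟩
  exact ⟨polarize k f, polarize_mem f.2, congrArg Subtype.val hf⟩

instance hwSpace_finite (k s t : ℕ) : Module.Finite ℂ (hwSpace k s t) :=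
  Module.Finite.of_injective (Submodule.inclusion inf_le_left) (Submodule.inclusion_injective _)

theorem finrank_hwSpace_zero (s : ℕ) : Module.finrank ℂ (hwSpace 3 s 0) = (s + 2).choose 2 := by
  have : hwSpace 3 s 0 = biHom 3 s 0 := by
    refine le_antisymm inf_le_left fun f hf => mem_hwSpace.2 ⟨hf, ?_⟩
    rw [polarizeUp_apply]
    exact Finset.sum_eq_zero fun j _ => by rw [pderiv_one_eq_zero hf, mul_zero]
  rw [this, finrank_biHom]
  simp

/-- Rank-nullity for the surjection E, whose kernel is the highest weight space. -/
theorem finrank_hwSpace_add {k s t : ℕ} (h : t ≤ s) :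
    Module.finrank ℂ (biHom k (s + 1) t) + Module.finrank ℂ (hwSpace k s (t + 1)) =
      Module.finrank ℂ (biHom k s (t + 1)) := by
  let L : biHom k s (t + 1) →ₗ[ℂ] biHom k (s + 1) t :=
    (polarizeUp k).toLinearMap.restrict fun f hf => polarizeUp_mem hf
  have hr : LinearMap.range L = ⊤ := by
    rw [LinearMap.range_eq_top]
    rintro ⟨g, hg⟩
    obtain ⟨f, hf, rfl⟩ := exists_polarizeUp_eq h hg
    exact ⟨⟨f, hf⟩, rfl⟩
  have hk : (LinearMap.ker L).map (biHom k s (t + 1)).subtype = hwSpace k s (t + 1) := by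
    ext f
    simp only [Submodule.mem_map, LinearMap.mem_ker, Submodule.subtype_apply, mem_hwSpace]
    constructor
    · rintro ⟨f, hf, rfl⟩
      exact ⟨f.2, congrArg Subtype.val hf⟩
    · rintro ⟨hf, h0⟩
      exact ⟨⟨f, hf⟩, Subtype.ext h0, rfl⟩
  have := LinearMap.finrank_range_add_finrank_ker L
  rwa [hr, finrank_top, (Submodule.equivMapOfInjective _ (Submodule.subtype_injective _)
    (LinearMap.ker L)).finrank_eq, hk] at this

theorem two_mul_finrank_hwSpace (a b : ℕ) :
    2 * Module.finrank ℂ (hwSpace 3 (a + b) a) = (b + 1) * (a + 1) * (a + b + 2) := by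
  have hc : ∀ n : ℕ, 2 * (n + 2).choose 2 = (n + 2) * (n + 1) := fun n => by
    rw [Nat.choose_two_right, Nat.mul_div_cancel' (Nat.even_mul_pred_self _).two_dvd]
    rfl
  cases a with
  | zero =>
    rw [finrank_hwSpace_zero, hc]
    ring
  | succ a =>
    have := finrank_hwSpace_add (k := 3) (s := a + 1 + b) (t := a) (by omega)
    rw [finrank_biHom, finrank_biHom] at this
    have h1 := hc (a + 1 + b + 1)
    have h2 := hc a
    have h3 := hc (a + 1 + b)
    have h4 := hc (a + 1)
    have : ((a : ℤ) + 1 + b + 3) * (a + 1 + b + 2) * ((a + 2) * (a + 1)) +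
        4 * Module.finrank ℂ (hwSpace 3 (a + 1 + b) (a + 1)) =
        (a + 1 + b + 2) * (a + 1 + b + 1) * ((a + 3) * (a + 2)) := by
      zify at this h1 h2 h3 h4
      linear_combination 4 * this - 2 * (a + 2).choose 2 * h1 -
        (((a : ℤ) + 1 + b + 3) * (a + 1 + b + 2)) * h2 + 2 * (a + 1 + 2).choose 2 * h3 +
        ((a : ℤ) + 1 + b + 2) * (a + 1 + b + 1) * h4
    zify
    refine mul_left_cancel₀ (two_ne_zero (α := ℤ)) ?_
    linear_combination this

end HighestWeight

/-! ### Exactness of the gradient and curl -/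

section Exactness

open MvPolynomial

theorem minorTwo_ne_zero {k : ℕ} {i j : Fin k} (h : i ≠ j) : (minorTwo i j : MatrixPoly k) ≠ 0 := by
  intro h0
  -- At this point the submatrix on columns i, j is the identity, so the minor takes the value 1.
  have := congrArg (MvPolynomial.eval fun p : ℕ × Fin k =>
    if p = (0, i) ∨ p = (1, j) then (1 : ℂ) else 0) h0
  simp [minorTwo, h, h.symm] at this

theorem polarize_X_zero {k : ℕ} (j : Fin k) : polarize k (X (0, j)) = X (1, j) := by
  simp [polarize]

theorem polarize_X_one {k : ℕ} (j : Fin k) : polarize k (X (1, j)) = 0 := by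
  simp [polarize]

/-- Curl of gradient is zero. The constants differ by one because a new cell in the second row
shortens the difference of the rows by one; with this choice the terms in f, Ff and F²f are each
symmetric in i and j. -/
theorem addCellPoly_comm {k : ℕ} (c : ℕ) (i j : Fin k) (f : MatrixPoly k) :
    addCellPoly k c (Pi.single i 1) (addCellPoly k (c + 1 : ℕ) (Pi.single j 1) f) =
      addCellPoly k c (Pi.single j 1) (addCellPoly k (c + 1 : ℕ) (Pi.single i 1) f) := by
  simp only [addCellPoly_single, map_sub, Derivation.leibniz, polarize_X_zero, polarize_X_one,
    Derivation.map_natCast, smul_eq_mul]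
  push_cast
  ring

/-- Eliminating Ff from the equations for i and j leaves c times a nonzero minor times f. -/
theorem eq_zero_of_addCellPoly_eq_zero {k c : ℕ} (hc : c ≠ 0) {i j : Fin k} (hij : i ≠ j)
    {f : MatrixPoly k} (h : ∀ l, addCellPoly k c (Pi.single l 1) f = 0) : f = 0 := by
  have hi := h i
  have hj := h j
  rw [addCellPoly_single] at hi hj
  have : (c : MatrixPoly k) * (minorTwo i j * f) = 0 := by
    rw [minorTwo]
    linear_combination X (0, i) * hj - X (0, j) * hi
  exact (mul_eq_zero.1 ((mul_eq_zero.1 this).resolve_left (Nat.cast_ne_zero.2 hc))).resolve_left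
    (minorTwo_ne_zero hij)

/-- The divergence identity behind the exactness of the complex of the operators `addCellPoly`. -/
theorem divergence_identity {a b : ℕ} {u : Fin 3 → MatrixPoly 3}
    (hu : ∀ j, u j ∈ hwSpace 3 (a + b + 1) a)
    (hc : ∀ i j, addCellPoly 3 (b + 1 : ℕ) (Pi.single i 1) (u j) =
      addCellPoly 3 (b + 1 : ℕ) (Pi.single j 1) (u i)) (j : Fin 3) :
    (((b + 1) * (a + 1) : ℕ) : MatrixPoly 3) * u j =
      addCellPoly 3 (b + 1 : ℕ) (Pi.single j 1) (∑ i, pderiv (1, i) (u i)) -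
        X (0, j) * ∑ i, pderiv (0, i) (u i) := by
  have hX0 : ∀ i l : Fin 3, pderiv (1, i) (X (0, l) : MatrixPoly 3) = 0 := fun i l => by
    simp [pderiv_X]
  have hX1 : ∀ i l : Fin 3, pderiv (1, i) (X (1, l) : MatrixPoly 3) = if i = l then 1 else 0 :=
    fun i l => by
      by_cases h : i = l
      · simp [h]
      · simp [pderiv_X, h, Ne.symm h]
  have hnat : ∀ (i : Fin 3) (n : ℕ), pderiv (1, i) (n : MatrixPoly 3) = 0 := fun i n =>
    Derivation.map_natCast _ n
  -- The commutators [∂_{1,i}, X_{1,i}] contribute 3, row 1 has degree a, and EF acts as b+1, so the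
  -- scalar is (b+1)(3 + a - 1). The dimension 3 of V enters here.
  have hl : ∑ i, pderiv (1, i) (addCellPoly 3 (b + 1 : ℕ) (Pi.single i 1) (u j)) =
      (((b + 1) * (a + 2) : ℕ) : MatrixPoly 3) * u j := by
    have h1 := rowEuler_one_eq (hu j).1
    have h2 := polarizeUp_polarize_of_mem (hu j).1
    rw [(mem_hwSpace.1 (hu j)).2, map_zero, polarizeUp_apply] at h2
    rw [Fin.sum_univ_three] at h1 h2 ⊢
    simp only [addCellPoly_single, map_sub, Derivation.leibniz, hX0, hX1, hnat, smul_eq_mul,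
      if_true, mul_zero, add_zero, mul_one]
    push_cast at h2 ⊢
    linear_combination ((b : MatrixPoly 3) + 1) * h1 - h2
  have hr : ∑ i, pderiv (1, i) (addCellPoly 3 (b + 1 : ℕ) (Pi.single j 1) (u i)) =
      ((b + 1 : ℕ) : MatrixPoly 3) * u j +
      addCellPoly 3 (b + 1 : ℕ) (Pi.single j 1) (∑ i, pderiv (1, i) (u i)) -
        X (0, j) * ∑ i, pderiv (0, i) (u i) := by
    have : ∀ i, pderiv (1, i) (addCellPoly 3 (b + 1 : ℕ) (Pi.single j 1) (u i)) =
        (if i = j then ((b + 1 : ℕ) : MatrixPoly 3) * u i else 0) +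
          addCellPoly 3 (b + 1 : ℕ) (Pi.single j 1) (pderiv (1, i) (u i)) -
          X (0, j) * pderiv (0, i) (u i) := fun i => by
      simp only [addCellPoly_single, map_sub, Derivation.leibniz, hX0, hX1, hnat, smul_eq_mul,
        pderiv_one_polarize]
      split_ifs <;> ring
    simp only [this, Finset.sum_sub_distrib, Finset.sum_add_distrib, map_sum, Finset.mul_sum,
      Finset.sum_ite_eq', Finset.mem_univ, if_true]
  -- Curl-freeness identifies the two divergences just computed.
  rw [Finset.sum_congr rfl fun i _ => congrArg (pderiv (1, i)) (hc i j), hr] at hl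
  push_cast at hl ⊢
  linear_combination -hl

/-- Exactness in the middle of the complex of the operators `addCellPoly`. -/
theorem exact_addCellPoly {a b : ℕ} {u : Fin 3 → MatrixPoly 3}
    (hu : ∀ j, u j ∈ hwSpace 3 (a + b + 1) a)
    (hc : ∀ i j, addCellPoly 3 (b + 1 : ℕ) (Pi.single i 1) (u j) =
      addCellPoly 3 (b + 1 : ℕ) (Pi.single j 1) (u i)) (j : Fin 3) :
    (((b + 2) * (a + 1) : ℕ) : MatrixPoly 3) * u j =
      addCellPoly 3 (b + 1 + 1 : ℕ) (Pi.single j 1) (∑ i, pderiv (1, i) (u i)) := by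
  set f := ∑ i, pderiv (1, i) (u i)
  set g := ∑ i, pderiv (0, i) (u i)
  -- The divergence f has row difference b+2, so its gradient needs the constant b+2 and not the b+1
  -- of the divergence identity. Changing the constant produces Ff, which is absorbed into `g'`.
  set g' := ((b + 2 : ℕ) : MatrixPoly 3) * g + polarize 3 f with hg'
  have hb : ((b + 1 : ℕ) : MatrixPoly 3) ≠ 0 := Nat.cast_ne_zero.2 (by omega)
  have key : ∀ j, (((b + 2) * (b + 1) * (a + 1) : ℕ) : MatrixPoly 3) * u j =
      ((b + 1 : ℕ) : MatrixPoly 3) * addCellPoly 3 (b + 1 + 1 : ℕ) (Pi.single j 1) f -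
        X (0, j) * g' := fun j => by
    have h := divergence_identity hu hc j
    rw [addCellPoly_single] at h ⊢
    push_cast at h hg' ⊢
    rw [hg']
    linear_combination ((b : MatrixPoly 3) + 2) * h
  have hmul : ∀ (n : ℕ) (v : Fin 3 → ℂ) (p : MatrixPoly 3),
      addCellPoly 3 (b + 1 : ℕ) v ((n : MatrixPoly 3) * p) =
        (n : MatrixPoly 3) * addCellPoly 3 (b + 1 : ℕ) v p := fun n v p => by
    rw [← nsmul_eq_mul, map_nsmul, nsmul_eq_mul]
  -- The triple X_{0,j} g' is curl-free, being a combination of the curl-free `u` and a gradient.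
  -- Its curl is also a nonzero multiple of a minor times g', which forces g' = 0.
  have hclosed : addCellPoly 3 (b + 1 : ℕ) (Pi.single 0 1) (X (0, 1) * g') =
      addCellPoly 3 (b + 1 : ℕ) (Pi.single 1 1) (X (0, 0) * g') := by
    have h0 := congrArg (addCellPoly 3 (b + 1 : ℕ) (Pi.single 0 1)) (key 1)
    have h1 := congrArg (addCellPoly 3 (b + 1 : ℕ) (Pi.single 1 1)) (key 0)
    rw [map_sub, hmul, hmul] at h0 h1
    linear_combination h0 - h1 -
      ((((b + 2) * (b + 1) * (a + 1) : ℕ) : MatrixPoly 3)) * hc 0 1 +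
      ((b + 1 : ℕ) : MatrixPoly 3) * addCellPoly_comm (b + 1) 0 1 f
  have hg0 : g' = 0 := by
    rw [addCellPoly_single, addCellPoly_single, Derivation.leibniz, Derivation.leibniz,
      polarize_X_zero, polarize_X_zero, smul_eq_mul, smul_eq_mul, smul_eq_mul, smul_eq_mul]
      at hclosed
    have : ((b + 2 : ℕ) : MatrixPoly 3) * (minorTwo 0 1 * g') = 0 := by
      rw [minorTwo]
      push_cast at hclosed ⊢
      linear_combination -hclosed
    exact (mul_eq_zero.1 ((mul_eq_zero.1 this).resolve_left
      (Nat.cast_ne_zero.2 (by omega)))).resolve_left (minorTwo_ne_zero (by decide))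
  refine mul_left_cancel₀ hb ?_
  have h := key j
  rw [hg0, mul_zero, sub_zero] at h
  rw [← h]
  push_cast
  ring

end Exactness

/-! ### Kernel and rank of the curl -/

section TransposedFlattening

/-- The transpose of the first Koszul flattening of `T_{a,b}`: the curl of a triple of elements of
`S_μ V` with respect to `φ`. -/
def curl (a b : ℕ) : (Fin 3 → SMu a b) →ₗ[ℂ] (Fin 3 → SNu a b) :=
  LinearMap.pi fun i =>
    phi a b (Pi.single (i + 1) 1) ∘ₗ LinearMap.proj (i + 2) -
      phi a b (Pi.single (i + 2) 1) ∘ₗ LinearMap.proj (i + 1)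

theorem curl_apply (a b : ℕ) (u : Fin 3 → SMu a b) (i : Fin 3) :
    curl a b u i = phi a b (Pi.single (i + 1) 1) (u (i + 2)) -
      phi a b (Pi.single (i + 2) 1) (u (i + 1)) := rfl

theorem phi_coe (a b : ℕ) (v : Fin 3 → ℂ) (u : SMu a b) :
    (phi a b v u : MatrixPoly 3) = addCellPoly 3 (b + 1 : ℕ) v u := by
  push_cast
  rfl

/-- Indices are taken modulo 3, and any two distinct ones are l + 1 and l + 2 in some order, so
three components encode all the symmetry conditions. -/
theorem curl_eq_zero_iff {a b : ℕ} {u : Fin 3 → SMu a b} :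
    curl a b u = 0 ↔ ∀ i j, addCellPoly 3 (b + 1 : ℕ) (Pi.single i 1) (u j) =
      addCellPoly 3 (b + 1 : ℕ) (Pi.single j 1) (u i) := by
  have h : ∀ i j, addCellPoly 3 (b + 1 : ℕ) (Pi.single i 1) (u j) =
      addCellPoly 3 (b + 1 : ℕ) (Pi.single j 1) (u i) ↔
      phi a b (Pi.single i 1) (u j) = phi a b (Pi.single j 1) (u i) := fun i j => by
    rw [Subtype.ext_iff, phi_coe, phi_coe]
  simp only [h, funext_iff, curl_apply, Pi.zero_apply, sub_eq_zero]
  constructor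
  · intro h i j
    have hij : ∀ i j : Fin 3, i = j ∨ ∃ l, (i = l + 1 ∧ j = l + 2) ∨ (i = l + 2 ∧ j = l + 1) := by
      decide
    rcases hij i j with rfl | ⟨l, ⟨rfl, rfl⟩ | ⟨rfl, rfl⟩⟩
    · rfl
    · exact h l
    · exact (h l).symm
  · intro h i
    exact h _ _

theorem mem_SMu {a b : ℕ} {f : MatrixPoly 3} : f ∈ SMu a b ↔ f ∈ hwSpace 3 (a + b + 1) a := by
  rw [SMu, schurModule_eq_hwSpace]

/-- For a = 0 no variable of row 1 occurs, so the divergence in `exact_addCellPoly` vanishes. -/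
theorem ker_curl_zero (b : ℕ) : LinearMap.ker (curl 0 b) = ⊥ := by
  rw [LinearMap.ker_eq_bot']
  intro u hu
  have hu' : ∀ j, (u j : MatrixPoly 3) ∈ hwSpace 3 (0 + b + 1) 0 := fun j => mem_SMu.1 (u j).2
  funext j
  have h := exact_addCellPoly hu' (curl_eq_zero_iff.1 hu) j
  rw [Finset.sum_eq_zero fun i _ => pderiv_one_eq_zero (hu' i).1 i, map_zero] at h
  exact Subtype.ext ((mul_eq_zero.1 h).resolve_left (Nat.cast_ne_zero.2 (by simp)))

/-- The gradient of a highest weight vector with respect to `φ`. -/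
def grad (a b : ℕ) : hwSpace 3 (a + 1 + b + 1) a →ₗ[ℂ] (Fin 3 → SMu (a + 1) b) :=
  LinearMap.pi fun i =>
    (addCellPoly 3 (b + 1 + 1 : ℕ) (Pi.single i 1)).restrict fun _ hf =>
      mem_SMu.2 (addCellPoly_mem_hwSpace (by omega) _ hf)

theorem grad_apply_coe (a b : ℕ) (f : hwSpace 3 (a + 1 + b + 1) a) (i : Fin 3) :
    (grad a b f i : MatrixPoly 3) = addCellPoly 3 (b + 1 + 1 : ℕ) (Pi.single i 1) f := rfl

theorem grad_injective (a b : ℕ) : Function.Injective (grad a b) := by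
  rw [← LinearMap.ker_eq_bot, LinearMap.ker_eq_bot']
  intro f hf
  refine Subtype.ext (eq_zero_of_addCellPoly_eq_zero (c := b + 1 + 1) (by omega)
    (show (0 : Fin 3) ≠ 1 by decide) fun l => ?_)
  exact congrArg Subtype.val (congrFun hf l)

theorem range_grad (a b : ℕ) : LinearMap.range (grad a b) = LinearMap.ker (curl (a + 1) b) := by
  apply le_antisymm
  · rintro _ ⟨f, rfl⟩
    exact curl_eq_zero_iff.2 fun i j => addCellPoly_comm (b + 1) i j _
  · intro u hu
    have hu' : ∀ j, (u j : MatrixPoly 3) ∈ hwSpace 3 (a + 1 + b + 1) (a + 1) := fun j =>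
      mem_SMu.1 (u j).2
    have h := exact_addCellPoly hu' (curl_eq_zero_iff.1 hu)
    -- Exactness gives the potential only up to this scalar, which must be invertible.
    have hn : (((b + 2) * (a + 1 + 1) : ℕ) : ℂ) ≠ 0 := by
      exact_mod_cast (by positivity : (b + 2) * (a + 1 + 1) ≠ 0)
    rw [← Submodule.smul_mem_iff _ hn]
    refine ⟨⟨∑ i, MvPolynomial.pderiv (1, i) (u i : MatrixPoly 3),
      Submodule.sum_mem _ fun i _ => pderiv_one_mem_hwSpace (hu' i) i⟩, ?_⟩
    funext j
    refine Subtype.ext ?_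
    rw [grad_apply_coe, ← h, Pi.smul_apply, Submodule.coe_smul, Nat.cast_smul_eq_nsmul,
      nsmul_eq_mul]

theorem two_mul_finrank_SMu (a b : ℕ) :
    2 * Module.finrank ℂ (SMu a b) = (b + 2) * (a + 1) * (a + b + 3) := by
  rw [SMu, schurModule_eq_hwSpace]
  exact two_mul_finrank_hwSpace a (b + 1)

theorem two_mul_finrank_SNu (a b : ℕ) :
    2 * Module.finrank ℂ (SNu a b) = (b + 1) * (a + 2) * (a + b + 3) := by
  rw [SNu, schurModule_eq_hwSpace, show a + b + 1 = a + 1 + b by omega, two_mul_finrank_hwSpace]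
  ring

theorem two_mul_finrank_ker_curl (a b : ℕ) :
    2 * Module.finrank ℂ (LinearMap.ker (curl a b)) = (b + 3) * a * (a + b + 3) := by
  cases a with
  | zero => rw [ker_curl_zero, finrank_bot]; ring
  | succ a =>
    rw [← range_grad, LinearMap.finrank_range_of_inj (grad_injective a b),
      show a + 1 + b + 1 = a + (b + 2) by omega, two_mul_finrank_hwSpace]
    ring

theorem linRank_curl (a b : ℕ) :
    linRank (curl a b) =
      Module.finrank ℂ (SMu a b) + Module.finrank ℂ (SNu a b) + a + b + 3 := by
  have h := LinearMap.finrank_range_add_finrank_ker (curl a b)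
  rw [Module.finrank_pi_fintype] at h
  simp only [Finset.sum_const, Finset.card_univ, Fintype.card_fin, smul_eq_mul] at h
  have h1 := two_mul_finrank_SMu a b
  have h2 := two_mul_finrank_SNu a b
  have h3 := two_mul_finrank_ker_curl a b
  rw [linRank]
  zify at h h1 h2 h3 ⊢
  refine mul_left_cancel₀ (two_ne_zero (α := ℤ)) ?_
  linear_combination 2 * h + 2 * h1 - h2 - h3

end TransposedFlattening

/-! ### The Koszul flattening as a transposed curl -/

section Transpose

/-- The pairing `ℂ³ ⊗ M* → (M³)*`. -/
def coordPairing (M : Type*) [AddCommGroup M] [Module ℂ M] :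
    (Fin 3 → ℂ) ⊗[ℂ] Module.Dual ℂ M →ₗ[ℂ] Module.Dual ℂ (Fin 3 → M) :=
  TensorProduct.lift (LinearMap.mk₂ ℂ (fun w β => ∑ i, w i • (β ∘ₗ LinearMap.proj i))
    (fun w w' β => by simp [add_smul, Finset.sum_add_distrib])
    (fun c w β => by simp [mul_smul, Finset.smul_sum])
    (fun w β β' => by simp [LinearMap.add_comp, Finset.sum_add_distrib])
    (fun c w β => by
      simp only [LinearMap.smul_comp, Finset.smul_sum, smul_comm c]))

theorem coordPairing_tmul {M : Type*} [AddCommGroup M] [Module ℂ M] (w : Fin 3 → ℂ)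
    (β : Module.Dual ℂ M) (u : Fin 3 → M) :
    coordPairing M (w ⊗ₜ β) u = ∑ i, w i * β (u i) := by
  simp [coordPairing, LinearMap.sum_apply]

theorem coordPairing_surjective (M : Type*) [AddCommGroup M] [Module ℂ M] :
    Function.Surjective (coordPairing M) := by
  intro θ
  refine ⟨∑ j, Pi.single j 1 ⊗ₜ (θ ∘ₗ LinearMap.single ℂ (fun _ => M) j), ?_⟩
  refine LinearMap.ext fun u => ?_
  rw [map_sum, LinearMap.sum_apply]
  simp only [coordPairing_tmul, Pi.single_apply, ite_mul, one_mul, zero_mul, Finset.sum_ite_eq',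
    Finset.mem_univ, if_true, LinearMap.comp_apply, LinearMap.single_apply]
  rw [← map_sum, Finset.univ_sum_single]

/-- Source and target have the same finite dimension, so surjectivity suffices. -/
theorem coordPairing_injective (M : Type*) [AddCommGroup M] [Module ℂ M] [Module.Finite ℂ M] :
    Function.Injective (coordPairing M) := by
  rw [LinearMap.injective_iff_surjective_of_finrank_eq_finrank]
  · exact coordPairing_surjective M
  · rw [Module.finrank_tensorProduct, Subspace.dual_finrank_eq, Subspace.dual_finrank_eq,
      Module.finrank_pi_fintype, Module.finrank_pi_fintype]
    simp

/-- Coordinates on the dual of `ℂ³`. -/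
def dualCoord : Module.Dual ℂ (Fin 3 → ℂ) ≃ₗ[ℂ] (Fin 3 → ℂ) :=
  (Pi.basisFun ℂ (Fin 3)).dualBasis.equivFun

theorem dualCoord_apply (f : Module.Dual ℂ (Fin 3 → ℂ)) (i : Fin 3) :
    dualCoord f i = f (Pi.single i 1) := by
  simp [dualCoord]

open scoped Matrix in
/-- The cross product, as an alternating map on the dual of `ℂ³`. -/
def crossAlternating : Module.Dual ℂ (Fin 3 → ℂ) [⋀^Fin 2]→ₗ[ℂ] (Fin 3 → ℂ) where
  toFun f := dualCoord (f 0) ⨯₃ dualCoord (f 1)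
  map_update_add' f i x y := by fin_cases i <;> simp
  map_update_smul' f i c x := by fin_cases i <;> simp
  map_eq_zero_of_eq' f i j h hij := by
    fin_cases i <;> fin_cases j <;> simp_all

/-- The identification of `Λ²(ℂ³)*` with `ℂ³`. -/
def crossMap : (⋀[ℂ]^2 (Module.Dual ℂ (Fin 3 → ℂ))) →ₗ[ℂ] (Fin 3 → ℂ) :=
  exteriorPower.alternatingMapLinearEquiv crossAlternating

open scoped Matrix in
theorem crossMap_ιMulti (f g : Module.Dual ℂ (Fin 3 → ℂ)) :
    crossMap (exteriorPower.ιMulti ℂ 2 ![f, g]) = dualCoord f ⨯₃ dualCoord g := by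
  rw [crossMap, exteriorPower.alternatingMapLinearEquiv_apply_ιMulti]
  rfl

theorem crossMap_surjective : Function.Surjective crossMap := by
  intro w
  -- The witness uses e_{i+1} × e_{i+2} = e_i with indices modulo 3.
  refine ⟨∑ i, w i • exteriorPower.ιMulti ℂ 2
    ![dualCoord.symm (Pi.single (i + 1) 1), dualCoord.symm (Pi.single (i + 2) 1)], ?_⟩
  simp only [map_sum, map_smul, crossMap_ιMulti, LinearEquiv.apply_symm_apply]
  ext i
  fin_cases i <;> simp [Fin.sum_univ_three, cross_apply, Pi.single_apply]

theorem crossMap_injective : Function.Injective crossMap := by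
  rw [LinearMap.injective_iff_surjective_of_finrank_eq_finrank]
  · exact crossMap_surjective
  · rw [exteriorPower.finrank_eq, Subspace.dual_finrank_eq, Module.finrank_pi]
    simp

theorem contractThird_tmul {A B C : Type*} [AddCommGroup A] [Module ℂ A] [AddCommGroup B]
    [Module ℂ B] [AddCommGroup C] [Module ℂ C] (x : A) (τ : B ⊗[ℂ] C) (γ : Module.Dual ℂ C) :
    contractThird (x ⊗ₜ[ℂ] τ) γ = x ⊗ₜ (TensorProduct.rid ℂ B (γ.lTensor B τ)) := rfl

theorem rid_lTensor_eq_comp {B C : Type*} [AddCommGroup B] [Module ℂ B] [AddCommGroup C]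
    [Module ℂ C] (τ : Module.Dual ℂ B ⊗[ℂ] C) (γ : Module.Dual ℂ C) :
    TensorProduct.rid ℂ (Module.Dual ℂ B) (γ.lTensor _ τ) = γ ∘ₗ dualTensorHom ℂ B C τ := by
  induction τ with
  | zero => simp
  | add x y hx hy => simp only [map_add, hx, hy, LinearMap.comp_add]
  | tmul β c =>
    ext x
    simp [mul_comm]

/-- The expansion of `T_{a,b}` in the dual basis of `V*`. -/
theorem Tab_eq_sum (a b : ℕ) :
    Tab a b = ∑ j, dualCoord.symm (Pi.single j 1) ⊗ₜ[ℂ]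
      (dualTensorHomEquiv ℂ (SMu a b) (SNu a b)).symm (phi a b (Pi.single j 1)) := by
  rw [Tab, LinearEquiv.symm_apply_eq, map_sum]
  refine LinearMap.ext fun v => ?_
  have hv : v = ∑ j, v j • (Pi.single j 1 : Fin 3 → ℂ) := by
    ext i
    simp [Pi.single_apply]
  have hc : ∀ j, dualCoord.symm (Pi.single j 1) v = v j := fun j => by
    have h : dualCoord.symm (Pi.single j 1) = LinearMap.proj j := by
      rw [LinearEquiv.symm_apply_eq]
      ext i
      simp [dualCoord_apply, Pi.single_apply, eq_comm]
    rw [h, LinearMap.proj_apply]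
  rw [LinearMap.sum_apply]
  have ht : ∀ (β : Module.Dual ℂ (Fin 3 → ℂ)) (w : Module.Dual ℂ (SMu a b) ⊗[ℂ] SNu a b),
      dualTensorHomEquiv ℂ (Fin 3 → ℂ) _ (β ⊗ₜ[ℂ] w) v = β v • w := fun _ _ => rfl
  simp only [ht, hc]
  conv_lhs => rw [hv]
  simp

theorem contractThird_Tab (a b : ℕ) (γ : Module.Dual ℂ (SNu a b)) :
    contractThird (Tab a b) γ =
      ∑ j, dualCoord.symm (Pi.single j 1) ⊗ₜ[ℂ] (γ ∘ₗ phi a b (Pi.single j 1)) := by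
  have h : ∀ j, dualTensorHom ℂ (SMu a b) (SNu a b)
      ((dualTensorHomEquiv ℂ (SMu a b) (SNu a b)).symm (phi a b (Pi.single j 1))) =
      phi a b (Pi.single j 1) := fun j =>
    (dualTensorHomEquiv ℂ (SMu a b) (SNu a b)).apply_symm_apply _
  let c : Module.Dual ℂ (Fin 3 → ℂ) ⊗[ℂ] (Module.Dual ℂ (SMu a b) ⊗[ℂ] SNu a b) →ₗ[ℂ]
      Module.Dual ℂ (Fin 3 → ℂ) ⊗[ℂ] Module.Dual ℂ (SMu a b) :=
    ((TensorProduct.rid ℂ (Module.Dual ℂ (SMu a b))).toLinearMap ∘ₗ γ.lTensor _).lTensor _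
  have hcT : ∀ T, contractThird T γ = c T := fun _ => rfl
  rw [Tab_eq_sum, hcT, map_sum]
  refine Finset.sum_congr rfl fun j _ => ?_
  rw [← hcT, contractThird_tmul, rid_lTensor_eq_comp, h]

theorem koszulFlattening_Tab_tmul (a b : ℕ) (f : Module.Dual ℂ (Fin 3 → ℂ))
    (γ : Module.Dual ℂ (SNu a b)) :
    koszulFlattening (Tab a b) (f ⊗ₜ γ) =
      ∑ j, exteriorPower.ιMulti ℂ 2 ![f, dualCoord.symm (Pi.single j 1)] ⊗ₜ[ℂ]
        (γ ∘ₗ phi a b (Pi.single j 1)) := by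
  rw [koszulFlattening, LinearMap.comp_apply, LinearMap.comp_apply, LinearMap.lTensor_tmul,
    contractThird_Tab, TensorProduct.tmul_sum, map_sum, map_sum]
  refine Finset.sum_congr rfl fun j _ => ?_
  simp [wedgeLeft_apply]

/-- The identification of `Λ²V* ⊗ M*` with `(M³)*`. -/
def wedgePairing (M : Type*) [AddCommGroup M] [Module ℂ M] :
    (⋀[ℂ]^2 (Module.Dual ℂ (Fin 3 → ℂ))) ⊗[ℂ] Module.Dual ℂ M →ₗ[ℂ] Module.Dual ℂ (Fin 3 → M) :=
  coordPairing M ∘ₗ crossMap.rTensor (Module.Dual ℂ M)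

theorem wedgePairing_injective (M : Type*) [AddCommGroup M] [Module ℂ M] [Module.Finite ℂ M] :
    Function.Injective (wedgePairing M) :=
  (coordPairing_injective M).comp
    (Module.Flat.rTensor_preserves_injective_linearMap _ crossMap_injective)

/-- The identification of `V* ⊗ M*` with `(M³)*`. -/
def dualPairing (M : Type*) [AddCommGroup M] [Module ℂ M] :
    Module.Dual ℂ (Fin 3 → ℂ) ⊗[ℂ] Module.Dual ℂ M →ₗ[ℂ] Module.Dual ℂ (Fin 3 → M) :=
  coordPairing M ∘ₗ dualCoord.toLinearMap.rTensor (Module.Dual ℂ M)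

theorem dualPairing_surjective (M : Type*) [AddCommGroup M] [Module ℂ M] :
    Function.Surjective (dualPairing M) :=
  (coordPairing_surjective M).comp (LinearMap.rTensor_surjective _ dualCoord.surjective)

/-- The first Koszul flattening of `T_{a,b}` is the transpose of the curl. -/
theorem wedgePairing_comp_koszulFlattening (a b : ℕ) :
    wedgePairing (SMu a b) ∘ₗ koszulFlattening (Tab a b) =
      (curl a b).dualMap ∘ₗ dualPairing (SNu a b) := by
  refine TensorProduct.ext' fun f γ => LinearMap.ext fun u => ?_
  have hl : (wedgePairing (SMu a b) ∘ₗ koszulFlattening (Tab a b)) (f ⊗ₜ γ) u =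
      ∑ j, ∑ i, (crossProduct (dualCoord f) (Pi.single j 1)) i *
        γ (phi a b (Pi.single j 1) (u i)) := by
    rw [LinearMap.comp_apply, koszulFlattening_Tab_tmul, map_sum, LinearMap.sum_apply]
    refine Finset.sum_congr rfl fun j _ => ?_
    rw [wedgePairing, LinearMap.comp_apply, LinearMap.rTensor_tmul, crossMap_ιMulti,
      LinearEquiv.apply_symm_apply, coordPairing_tmul]
    rfl
  have hr : ((curl a b).dualMap ∘ₗ dualPairing (SNu a b)) (f ⊗ₜ γ) u =
      ∑ i, dualCoord f i * (γ (phi a b (Pi.single (i + 1) 1) (u (i + 2))) -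
        γ (phi a b (Pi.single (i + 2) 1) (u (i + 1)))) := by
    rw [LinearMap.comp_apply, LinearMap.dualMap_apply, dualPairing, LinearMap.comp_apply,
      LinearMap.rTensor_tmul, coordPairing_tmul]
    simp only [curl_apply, map_sub]
    rfl
  rw [hl, hr]
  have h1 : (1 : Fin 3) + 1 = 2 := rfl
  have h2 : (1 : Fin 3) + 2 = 0 := rfl
  have h3 : (2 : Fin 3) + 1 = 0 := rfl
  have h4 : (2 : Fin 3) + 2 = 1 := rfl
  simp only [Fin.sum_univ_three, cross_apply, zero_add, h1, h2, h3, h4]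
  simp
  ring

theorem linRank_eq_of_comp_eq {M N M' N' : Type*} [AddCommGroup M] [Module ℂ M] [AddCommGroup N]
    [Module ℂ N] [AddCommGroup M'] [Module ℂ M'] [AddCommGroup N'] [Module ℂ N']
    {F : M →ₗ[ℂ] N} {G : M' →ₗ[ℂ] N'} {e : N →ₗ[ℂ] N'} {d : M →ₗ[ℂ] M'}
    (he : Function.Injective e) (hd : Function.Surjective d) (h : e ∘ₗ F = G ∘ₗ d) :
    linRank F = linRank G := by
  have h1 : (LinearMap.range F).map e = LinearMap.range G := by
    rw [← LinearMap.range_comp, h, LinearMap.range_comp_of_range_eq_top _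
      (LinearMap.range_eq_top.2 hd)]
  rw [linRank, linRank, ← h1]
  exact (Submodule.equivMapOfInjective e he _).finrank_eq

theorem linRank_koszulFlattening_Tab (a b : ℕ) :
    linRank (koszulFlattening (Tab a b)) =
      Module.finrank ℂ (SMu a b) + Module.finrank ℂ (SNu a b) + a + b + 3 := by
  have h := linRank_eq_of_comp_eq
    (M := Module.Dual ℂ (Fin 3 → ℂ) ⊗[ℂ] Module.Dual ℂ (SNu a b))
    (N := (⋀[ℂ]^2 (Module.Dual ℂ (Fin 3 → ℂ))) ⊗[ℂ] Module.Dual ℂ (SMu a b))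
    (wedgePairing_injective (SMu a b)) (dualPairing_surjective (SNu a b))
    (wedgePairing_comp_koszulFlattening a b)
  rw [h, ← linRank_curl]
  exact LinearMap.finrank_range_dualMap_eq_finrank_range _

end Transpose

end

/-! ### Numerical consequences -/

theorem proposition7 (a b m n : ℕ)
    (hm : m = Module.finrank ℂ (SMu a b)) (hn : n = Module.finrank ℂ (SNu a b)) :
    -- the rank of the first Koszul flattening
    linRank (koszulFlattening (Tab a b)) = m + n + a + b + 3 ∧
    -- the border rank lower bound that it gives
    ⌈(linRank (koszulFlattening (Tab a b)) : ℚ) / (Nat.choose (3 - 1) 1 : ℚ)⌉₊ ≤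
      borderRank (Tab a b) ∧
    -- it exceeds the trivial bound only if a and b differ by at most one
    (max m n < ⌈(linRank (koszulFlattening (Tab a b)) : ℚ) / (Nat.choose (3 - 1) 1 : ℚ)⌉₊ →
      |(a : ℤ) - (b : ℤ)| ≤ 1) ∧
    (a = b → m = n ∧ m + a + 2 ≤ borderRank (Tab a b)) ∧
    (b = a + 1 → max m n = n ∧ n + ⌈(a : ℚ) / 2⌉₊ + 1 ≤ borderRank (Tab a b)) ∧
    (a = b + 1 → max m n = m ∧ m + ⌈(b : ℚ) / 2⌉₊ + 1 ≤ borderRank (Tab a b)) := by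
  have hrank := linRank_koszulFlattening_Tab a b
  have h1 := two_mul_finrank_SMu a b
  have h2 := two_mul_finrank_SNu a b
  have hbr := linRank_koszulFlattening_le (Tab a b)
  rw [Subspace.dual_finrank_eq, Module.finrank_pi, Fintype.card_fin] at hbr
  rw [← hm, ← hn] at hrank
  rw [← hm] at h1
  rw [← hn] at h2
  set R := borderRank (Tab a b)
  rw [hrank] at hbr ⊢
  have hceil : ∀ x y : ℕ, ⌈(x : ℚ) / 2⌉₊ ≤ y ↔ x ≤ 2 * y := fun x y => by
    rw [Nat.ceil_le, div_le_iff₀ (by norm_num)]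
    norm_cast
    rw [mul_comm]
  have hchoose : (Nat.choose (3 - 1) 1 : ℚ) = 2 := by norm_num
  rw [hchoose]
  refine ⟨rfl, (hceil _ _).2 (by omega), fun h => ?_, ?_, ?_, ?_⟩
  · rw [← not_le, hceil] at h
    -- If the bound exceeds both m and n, then |m - n| < a + b + 3, and this identity gives |a - b|
    -- < 2.
    have hd : (2 : ℤ) * (m - n) = (a - b) * (a + b + 3) := by
      zify at h1 h2
      linear_combination h1 - h2
    have h3 : 2 * m < m + n + a + b + 3 := by omega
    have h4 : 2 * n < m + n + a + b + 3 := by omega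
    zify at h3 h4
    have hs : (0 : ℤ) < a + b + 3 := by positivity
    have h5 : ((a : ℤ) - b) < 2 := by
      by_contra hcon
      nlinarith
    have h6 : -2 < ((a : ℤ) - b) := by
      by_contra hcon
      nlinarith
    rw [abs_le]
    constructor <;> omega
  · rintro rfl
    -- Here 2R ≥ 2m + 2a + 3, and parity rounds this up to R ≥ m + a + 2.
    have : 2 * m = 2 * n := by rw [h1, h2]; ring
    omega
  · rintro rfl
    have : 2 * n = 2 * m + 2 * (a + 2) := by rw [h1, h2]; ring
    -- The rank is 2n + a + 2, so R ≥ n + 1 and the truncated subtraction is exact. The last case is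
    -- the same with the roles exchanged.
    have hc : ⌈(a : ℚ) / 2⌉₊ ≤ R - n - 1 := (hceil _ _).2 (by omega)
    omega
  · rintro rfl
    have : 2 * m = 2 * n + 2 * (b + 2) := by rw [h1, h2]; ring
    have hc : ⌈(b : ℚ) / 2⌉₊ ≤ R - m - 1 := (hceil _ _).2 (by omega)
    omega
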